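/- **Conventions.** All semigroups are commutative with identity. An element $\infty$ is *nil* if $a+\infty=\infty$ for all $a$. A *nilsemigroup* is a semigroup with a nil element in which some positive multiple of every non-identity element is nil; it is *partly cancellative* if $a+b=a+c\neq\infty$ implies $b=c$. An *atom* is a non-identity element that is not a sum of two non-identity elements. If $N$ has atoms $(n_i)_{i\in I}$ with $I$ finite, write $\varphi_N(z)=\sum_i z_in_i$ for $z\in\mathbb Z_{\ge0}^I$, and $\mathsf Z_N(n)=\varphi_N^{-1}(n)$ for the set of *factorizations* of $n$. A *presentation* of $N$ is a set obtained from a set of pairs generating the congruence $\ker\varphi_N$ by omitting all pairs $(a,b)$ with $\varphi_N(a)$ nil; it is *minimal* if no proper subset of it is a presentation. An *outer Betti element* of a finite partly cancellative nilsemigroup $N$ is a set $B\subseteq\mathsf Z_N(\infty)$ such that (i) for each $i$ with $z_i>0$ for some $z\in B$, the set $\{z-e_i : z\in B,\ z_i>0\}$ equals $\mathsf Z_N(p)$ for some non-nil $p\in N$, and (ii) the graph with vertex set $B$, in which distinct $z,z'$ are adjacent when their supports intersect, is connected (in particular, $B\ne\emptyset$). A finite partly cancellative nilsemigroup is *staircase*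 if each of its non-nil elements factors uniquely as a sum of atoms. For $m\ge1$, the *Kunz cone* $\mathcal C_m\subseteq\mathbb R_{\ge0}^{m-1}$, with coordinates indexed by $\mathbb Z_m\setminus\{0\}$, is defined by $x_i+x_j\ge x_{i+j}$ for all nonzero $i,j\in\mathbb Z_m$ with $i+j\neq0$. Put $x_0=0$. For a face $F$ of $\mathcal C_m$, the *Kunz subgroup* of $F$ is $H=\{i\in\mathbb Z_m : x_i=0\text{ for all }x\in F\}$, and the *Kunz nilsemigroup* of $F$ is $N=(\mathbb Z_m/H)\cup\{\infty\}$, where $\infty$ is nil and $\overline a\oplus\overline b=\overline{a+b}$ if $x_a+x_b=x_{a+b}$ for all $x\in F$, and $\overline a\oplus\overline b=\infty$ otherwise. For two Kunz nilsemigroups $N$ and $N'$ with the same underlying set $(\mathbb Z_m/H)\cup\{\infty\}$, $N$ is a *refinement* of $N'$ if $\mathsf Z_{N'}(i)\subseteq\mathsf Z_N(i)$ for every non-nil $i$. A *numerical semigroup* is a cofinite submonoid $S$ of $\mathbb Z_{\ge0}$; $\eta(S)$ denotes the cardinality of any minimal presentation of $S$. For a positive $m\in S$, let $\operatorname{Ap}(S;m)=\{n\in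 S : n-m\notin S\}$. The *Kunz nilsemigroup* of $S$ (relative to $m$) is $\mathbb Z_m\cup\{\infty\}$ with the operation obtained from the quotient of $S$ that identifies all elements outside $\operatorname{Ap}(S;m)$ to a single nil element, by replacing each $n\in\operatorname{Ap}(S;m)$ with its class modulo $m$. **Theorem.** Let $N$ be the Kunz nilsemigroup of a face of $\mathcal C_m$, with Kunz subgroup $H$. 1. There is a staircase Kunz nilsemigroup $N'$ of a face of $\mathcal C_m$, on the same underlying set $(\mathbb Z_m/H)\cup\{\infty\}$ and with the same set of atoms, such that $N$ is a refinement of $N'$. 2. For every such $N'$: if $\rho$ is a minimal presentation of $N$, and $N$ and $N'$ have $\beta$ and $\beta'$ outer Betti elements, respectively, then $|\rho|+\beta\le\beta'$. 3. For every such $N'$: if $S$ and $S'$ are numerical semigroups containing $m$ whose Kunz nilsemigroups (relative to $m$) are $N$ and $N'$, respectively, and $m$ is a minimal generator of $S'$ (for instance, if $m$ is the smallest positive element of $S'$), then $\eta(S)\le\eta(S')$. -/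

import Mathlib

/-! ### Commutative monoids with a nil element: atoms, factorizations, presentations -/

namespace Kunz

section Generic

variable (N : Type*) [AddCommMonoid N]

/-- `n` is nil (an absorbing element, written `∞`). -/
def IsNil {N : Type*} [AddCommMonoid N] (n : N) : Prop := ∀ a : N, a + n = n

/-- A nilsemigroup: it has a nil element and every non-identity element is nilpotent. -/
def IsNilsemigroup : Prop :=
  (∃ n : N, IsNil n) ∧ ∀ a : N, a ≠ 0 → ∃ k : ℕ, 1 ≤ k ∧ IsNil (k • a)

/-- Partly cancellative: `a + b = a + c ≠ ∞` implies `b = c`. -/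
def IsPartlyCancellative : Prop :=
  ∀ a b c : N, a + b = a + c → ¬ IsNil (a + b) → b = c

/-- The atoms: non-identity elements that are not a sum of two non-identity elements.
For a numerical semigroup these are the minimal generators. -/
def atoms : Set N := {a | a ≠ 0 ∧ ∀ b c : N, b ≠ 0 → c ≠ 0 → a ≠ b + c}

/-- Exponent vectors on the atoms of `N`. -/
abbrev Fact : Type _ := atoms N →₀ ℕ

/-- The factorization homomorphism `z ↦ ∑ z_a • a`. -/
noncomputable def factHom : Fact N →+ N :=
  Finsupp.liftAddHom fun a : atoms N => multiplesHom N (a : N)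

/-- The set of factorizations of `n`. -/
def factorizations {N : Type*} [AddCommMonoid N] (n : N) : Set (Fact N) :=
  {z | factHom N z = n}

/-- `ρ` is a presentation of `N`: it is obtained from a set of pairs that generates the kernel
congruence of the factorization homomorphism by omitting the pairs at a nil element. -/
def IsPresentation (ρ : Set (Fact N × Fact N)) : Prop :=
  ∃ σ : Set (Fact N × Fact N),
    addConGen (fun a b => (a, b) ∈ σ) = AddCon.ker (factHom N) ∧
    ρ = {p ∈ σ | ¬ IsNil (factHom N p.1)}

/-- A presentation no proper subset of which is a presentation. -/
def IsMinimalPresentation (ρ : Set (Fact N × Fact N)) : Prop :=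
  Minimal (IsPresentation N) ρ

/-- The factorization graph `∇_B` on a set `B` of exponent vectors: distinct vectors are adjacent
when their supports intersect. -/
def factGraph {ι : Type*} (B : Set (ι →₀ ℕ)) : SimpleGraph B where
  Adj z w := z ≠ w ∧ ∃ i, i ∈ z.1.support ∧ i ∈ w.1.support
  symm := ⟨fun _ _ h => ⟨h.1.symm, h.2.imp fun _ hi => hi.symm⟩⟩
  loopless := ⟨fun _ h => h.1 rfl⟩

/-- `B - e_i = {z - e_i | z ∈ B, i ∈ supp z}`. -/
def subUnit {ι : Type*} (B : Set (ι →₀ ℕ)) (i : ι) : Set (ι →₀ ℕ) :=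
  (fun z => z - Finsupp.single i 1) '' {z ∈ B | i ∈ z.support}

/-- The set of outer Betti elements of `N`: the sets `B` of factorizations of `∞` such that
`B - e_i` is the set of all factorizations of some non-nil element for each `i ∈ supp B`, and
such that `∇_B` is connected (in particular `B` is non-empty). -/
def outerBettiElements : Set (Set (Fact N)) :=
  {B | (∀ z ∈ B, IsNil (factHom N z)) ∧
    (∀ i, (∃ z ∈ B, i ∈ z.support) → ∃ p : N, ¬ IsNil p ∧ subUnit B i = factorizations p) ∧
    (factGraph B).Connected}

/-- A staircase nilsemigroup: a finite, partly cancellative nilsemigroup in which every non-nil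
element factors uniquely as a sum of atoms. -/
def IsStaircase : Prop :=
  Finite N ∧ IsNilsemigroup N ∧ IsPartlyCancellative N ∧
    ∀ n : N, ¬ IsNil n → ∃! z : Fact N, z ∈ factorizations n

end Generic

/-! ### The Kunz cone and the Kunz nilsemigroup of a face -/

/-- The Kunz cone `𝒞_m`. A point of `ℝ^{m-1}`, with coordinates indexed by the nonzero elements
of `ℤ/m`, is encoded as a function on `ℤ/m` with value `0` at `0`. -/
def kunzCone (m : ℕ) : Set (ZMod m → ℝ) :=
  {x | x 0 = 0 ∧ (∀ i, 0 ≤ x i) ∧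
    ∀ i j : ZMod m, i ≠ 0 → j ≠ 0 → i + j ≠ 0 → x (i + j) ≤ x i + x j}

/-- The faces of the Kunz cone: the subsets cut out of it by turning some of its defining
inequalities into equalities. -/
def IsFace (m : ℕ) (F : Set (ZMod m → ℝ)) : Prop :=
  ∃ (Z : Set (ZMod m)) (T : Set (ZMod m × ZMod m)),
    (∀ p ∈ T, p.1 ≠ 0 ∧ p.2 ≠ 0 ∧ p.1 + p.2 ≠ 0) ∧
    F = {x ∈ kunzCone m | (∀ i ∈ Z, x i = 0) ∧ ∀ p ∈ T, x p.1 + x p.2 = x (p.1 + p.2)}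

/-- A face of `𝒞_m` whose Kunz subgroup `{0} ∪ {i | x_i = 0 for all x ∈ F}` is `H`. -/
structure KunzFace (m : ℕ) (H : AddSubgroup (ZMod m)) where
  /-- the points of the face -/
  carrier : Set (ZMod m → ℝ)
  isFace : IsFace m carrier
  mem_subgroup : ∀ i : ZMod m, i ∈ H ↔ i = 0 ∨ ∀ x ∈ carrier, x i = 0

theorem kunzCone_add_le {m : ℕ} {x : ZMod m → ℝ} (hx : x ∈ kunzCone m) (i j : ZMod m) :
    x (i + j) ≤ x i + x j := by
  obtain ⟨h0, hn, hs⟩ := hx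
  by_cases hi : i = 0
  · subst hi; simp [h0]
  by_cases hj : j = 0
  · subst hj; simp [h0]
  by_cases hij : i + j = 0
  · rw [hij, h0]; exact add_nonneg (hn i) (hn j)
  · exact hs i j hi hj hij

theorem IsFace.mem_cone {m : ℕ} {F : Set (ZMod m → ℝ)} (hF : IsFace m F) {x : ZMod m → ℝ}
    (hx : x ∈ F) : x ∈ kunzCone m := by
  obtain ⟨Z, T, -, rfl⟩ := hF
  exact hx.1

theorem kunzCone_nsmul_le {m : ℕ} {x : ZMod m → ℝ} (hx : x ∈ kunzCone m) (k : ℕ) (i : ZMod m) :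
    x (k • i) ≤ k * x i := by
  induction k with
  | zero => simp [hx.1]
  | succ k ih =>
    have := kunzCone_add_le hx (k • i) i
    rw [succ_nsmul]; push_cast; linarith

/-- Every face has a Kunz subgroup, so every face of `𝒞_m` gives a `KunzFace`. -/
theorem exists_kunzFace {m : ℕ} [NeZero m] {F : Set (ZMod m → ℝ)} (hF : IsFace m F) :
    ∃ (H : AddSubgroup (ZMod m)) (K : KunzFace m H), K.carrier = F := by
  refine ⟨{ carrier := {i | ∀ x ∈ F, x i = 0}, add_mem' := ?_, zero_mem' := ?_, neg_mem' := ?_ },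
    ⟨F, hF, ?_⟩, rfl⟩
  · intro a b ha hb x hx
    have hc := hF.mem_cone hx
    have h1 := kunzCone_add_le hc a b
    rw [ha x hx, hb x hx] at h1
    exact le_antisymm (by linarith) (hc.2.1 _)
  · exact fun x hx => (hF.mem_cone hx).1
  · intro a ha x hx
    have hc := hF.mem_cone hx
    have h1 := kunzCone_nsmul_le hc (m - 1) a
    have h2 : (m - 1) • a = -a := by
      have : (m - 1) • a + a = 0 := by
        rw [← succ_nsmul, Nat.sub_add_cancel (NeZero.one_le), nsmul_eq_mul]
        simp
      exact eq_neg_of_add_eq_zero_left this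
    rw [h2, ha x hx, mul_zero] at h1
    exact le_antisymm h1 (hc.2.1 _)
  · intro i
    constructor
    · exact fun h => Or.inr h
    · rintro (rfl | h)
      · exact fun x hx => (hF.mem_cone hx).1
      · exact h

section KunzNil

variable {m : ℕ} {H : AddSubgroup (ZMod m)}

theorem KunzFace.zero_on (F : KunzFace m H) {h : ZMod m} (hh : h ∈ H) {x : ZMod m → ℝ}
    (hx : x ∈ F.carrier) : x h = 0 := by
  rcases (F.mem_subgroup h).1 hh with rfl | h1
  · exact (F.isFace.mem_cone hx).1
  · exact h1 x hx

theorem KunzFace.eq_of_mk_eq (F : KunzFace m H) {a b : ZMod m}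
    (hab : (a : ZMod m ⧸ H) = (b : ZMod m ⧸ H)) {x : ZMod m → ℝ} (hx : x ∈ F.carrier) :
    x a = x b := by
  have hm : -a + b ∈ H := QuotientAddGroup.eq.1 hab
  have hc := F.isFace.mem_cone hx
  have h1 := kunzCone_add_le hc a (-a + b)
  have h2 := kunzCone_add_le hc b (-(-a + b))
  rw [F.zero_on hm hx] at h1
  rw [F.zero_on (H.neg_mem hm) hx] at h2
  have e1 : a + (-a + b) = b := by abel
  have e2 : b + -(-a + b) = a := by abel
  rw [e1] at h1
  rw [e2] at h2
  linarith

/-- The relation `x_a + x_b = x_{a+b}` for all `x ∈ F`, for cosets of the Kunz subgroup. -/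
def KunzFace.Tight (F : KunzFace m H) (q r : ZMod m ⧸ H) : Prop :=
  ∀ a b : ZMod m, (a : ZMod m ⧸ H) = q → (b : ZMod m ⧸ H) = r →
    ∀ x ∈ F.carrier, x a + x b = x (a + b)

/-- The relation does not depend on the chosen representatives. -/
theorem KunzFace.tight_mk (F : KunzFace m H) (a b : ZMod m) :
    F.Tight a b ↔ ∀ x ∈ F.carrier, x a + x b = x (a + b) := by
  refine ⟨fun h => h a b rfl rfl, fun h a' b' ha hb x hx => ?_⟩
  have hab : ((a' + b' : ZMod m) : ZMod m ⧸ H) = ((a + b : ZMod m) : ZMod m ⧸ H) := by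
    rw [QuotientAddGroup.mk_add, QuotientAddGroup.mk_add, ha, hb]
  rw [F.eq_of_mk_eq ha hx, F.eq_of_mk_eq hb hx, F.eq_of_mk_eq hab hx]
  exact h x hx

/-- The underlying set `(ℤ/m)/H ∪ {∞}` of the Kunz nilsemigroup of a face. -/
inductive KunzNil (F : KunzFace m H) : Type
  | nil : KunzNil F
  | of (q : ZMod m ⧸ H) : KunzNil F

open Classical in
/-- The operation `⊕`: `a ⊕ b = a + b` if `x_a + x_b = x_{a+b}` on the face, and `∞` otherwise. -/
noncomputable def KunzNil.add {F : KunzFace m H} : KunzNil F → KunzNil F → KunzNil F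
  | .of q, .of r => if F.Tight q r then .of (q + r) else .nil
  | _, _ => .nil

theorem KunzFace.tight_comm (F : KunzFace m H) (q r : ZMod m ⧸ H) :
    F.Tight q r ↔ F.Tight r q := by
  induction q using QuotientAddGroup.induction_on with | H a
  induction r using QuotientAddGroup.induction_on with | H b
  rw [F.tight_mk, F.tight_mk, add_comm a b]
  simp only [add_comm (_ : ℝ)]

theorem KunzFace.tight_zero (F : KunzFace m H) (q : ZMod m ⧸ H) : F.Tight 0 q := by
  induction q using QuotientAddGroup.induction_on with | H a
  rw [← QuotientAddGroup.mk_zero, F.tight_mk]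
  intro x hx
  simp [(F.isFace.mem_cone hx).1]

theorem KunzFace.tight_assoc (F : KunzFace m H) (q r s : ZMod m ⧸ H) :
    (F.Tight q r ∧ F.Tight (q + r) s) ↔ (F.Tight r s ∧ F.Tight q (r + s)) := by
  induction q using QuotientAddGroup.induction_on with | H a
  induction r using QuotientAddGroup.induction_on with | H b
  induction s using QuotientAddGroup.induction_on with | H c
  rw [← QuotientAddGroup.mk_add, ← QuotientAddGroup.mk_add]
  simp only [F.tight_mk]
  constructor
  · rintro ⟨h1, h2⟩
    refine ⟨fun x hx => ?_, fun x hx => ?_⟩ <;>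
    · have hc := F.isFace.mem_cone hx
      have e1 := h1 x hx
      have e2 := h2 x hx
      have l1 := kunzCone_add_le hc b c
      have l2 := kunzCone_add_le hc a (b + c)
      rw [add_assoc] at e2
      linarith
  · rintro ⟨h1, h2⟩
    refine ⟨fun x hx => ?_, fun x hx => ?_⟩ <;>
    · have hc := F.isFace.mem_cone hx
      have e1 := h1 x hx
      have e2 := h2 x hx
      have l1 := kunzCone_add_le hc a b
      have l2 := kunzCone_add_le hc (a + b) c
      rw [add_assoc] at l2
      first
        | linarith
        | (rw [add_assoc]; linarith)

/-- The Kunz nilsemigroup of a face. -/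
noncomputable instance (F : KunzFace m H) : AddCommMonoid (KunzNil F) where
  add := KunzNil.add
  zero := .of 0
  nsmul := @nsmulRec _ ⟨.of 0⟩ ⟨KunzNil.add⟩
  add_assoc := by
    rintro (_ | q) (_ | r) (_ | s) <;> change KunzNil.add (KunzNil.add _ _) _ =
      KunzNil.add _ (KunzNil.add _ _)
    all_goals try rfl
    · by_cases h : F.Tight q r <;> simp [KunzNil.add, h]
    · have := F.tight_assoc q r s
      by_cases h1 : F.Tight q r <;> by_cases h2 : F.Tight r s <;>
        by_cases h3 : F.Tight (q + r) s <;> by_cases h4 : F.Tight q (r + s) <;>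
        simp_all [KunzNil.add, add_assoc]
  zero_add := by
    rintro (_ | q) <;> change KunzNil.add (.of 0) _ = _
    · rfl
    · simp [KunzNil.add, F.tight_zero]
  add_zero := by
    rintro (_ | q) <;> change KunzNil.add _ (.of 0) = _
    · rfl
    · simp [KunzNil.add, (F.tight_comm q 0).2 (F.tight_zero q)]
  add_comm := by
    rintro (_ | q) (_ | r) <;> change KunzNil.add _ _ = KunzNil.add _ _
    all_goals try rfl
    have := F.tight_comm q r
    by_cases h : F.Tight q r <;> simp_all [KunzNil.add, add_comm q r]

/-- The Kunz nilsemigroups of two faces with the same Kunz subgroup have the same underlying set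
`(ℤ/m)/H ∪ {∞}`; this is the identity map between them. -/
def relabel (F F' : KunzFace m H) : KunzNil F → KunzNil F'
  | .nil => .nil
  | .of q => .of q

/-- The two Kunz nilsemigroups have the same atoms, as subsets of `(ℤ/m)/H ∪ {∞}`. -/
def SameAtoms (F F' : KunzFace m H) : Prop :=
  relabel F' F '' atoms (KunzNil F') = atoms (KunzNil F)

/-- The Kunz nilsemigroup `N` of `F` is a refinement of the Kunz nilsemigroup `N'` of `F'`: every
factorization in `N'` of a non-nil element is also a factorization of it in `N`. Factorizations of
the two are compared as finitely supported exponent vectors on `(ℤ/m)/H ∪ {∞}`. -/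
def Refines (F F' : KunzFace m H) : Prop :=
  ∀ q : ZMod m ⧸ H,
    (fun z : Fact (KunzNil F') => z.mapDomain fun a => relabel F' F a.1) ''
        factorizations (KunzNil.of q : KunzNil F') ⊆
      (fun z : Fact (KunzNil F) => z.mapDomain Subtype.val) ''
        factorizations (KunzNil.of q : KunzNil F)

end KunzNil

/-! ### The Kunz nilsemigroup of a numerical semigroup -/

/-- A numerical semigroup: a cofinite additive submonoid of `ℕ`. -/
def IsNumericalSemigroup (S : AddSubmonoid ℕ) : Prop := {n : ℕ | n ∉ S}.Finite

/-- The Apéry set `{n ∈ S | n - m ∉ S}`, as a set of elements of `S`. -/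
def apery (S : AddSubmonoid ℕ) (m : ℕ) : Set S := {n | ∀ k : S, (n : ℕ) ≠ k + m}

theorem not_mem_apery_add {S : AddSubmonoid ℕ} {m : ℕ} {a : S} (ha : a ∉ apery S m) (b : S) :
    a + b ∉ apery S m := by
  simp only [apery, Set.mem_ofPred_eq, not_forall, not_not, ne_eq] at ha ⊢
  obtain ⟨k, hk⟩ := ha
  exact ⟨k + b, by push_cast; omega⟩

/-- The congruence on `S` that identifies all elements outside the Apéry set. -/
def aperyCon (S : AddSubmonoid ℕ) (m : ℕ) : AddCon S where
  r a b := a = b ∨ (a ∉ apery S m ∧ b ∉ apery S m)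
  iseqv := ⟨fun _ => Or.inl rfl, by
      rintro a b (h | h)
      · exact Or.inl h.symm
      · exact Or.inr h.symm, by
      rintro a b c (rfl | h) (rfl | h')
      · exact Or.inl rfl
      · exact Or.inr h'
      · exact Or.inr h
      · exact Or.inr ⟨h.1, h'.2⟩⟩
  add' := by
    rintro a b c d (rfl | h) (rfl | h')
    · exact Or.inl rfl
    · rw [add_comm a c, add_comm a d]
      exact Or.inr ⟨not_mem_apery_add h'.1 a, not_mem_apery_add h'.2 a⟩
    · exact Or.inr ⟨not_mem_apery_add h.1 c, not_mem_apery_add h.2 c⟩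
    · exact Or.inr ⟨not_mem_apery_add h.1 c, not_mem_apery_add h.2 d⟩

/-- The Kunz nilsemigroup of `S` (relative to `m`) is the Kunz nilsemigroup of the face `F`: the
quotient of `S` by the above congruence, with each non-nil element replaced by its residue class
modulo `m`, is the Kunz nilsemigroup of `F`. -/
def IsKunzNilsemigroupOf (S : AddSubmonoid ℕ) {m : ℕ} {H : AddSubgroup (ZMod m)}
    (F : KunzFace m H) : Prop :=
  ∃ e : (aperyCon S m).Quotient ≃+ KunzNil F,
    ∀ s : S, s ∈ apery S m →
      e (s : (aperyCon S m).Quotient) = KunzNil.of (((s : ℕ) : ZMod m) : ZMod m ⧸ H)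

end Kunz

namespace Kunz

/-! ### Counting the edges of a graph by rank over `ℚ`. -/

section LinearAlgebra

open Submodule

/-! The proof is a Gröbner degeneration. Take `X` in the relative interior of the face of `N'` and
weigh an exponent vector over the common atoms by the sum of the values of `X`. The weight of a
vector is at least the value of `X` at its coset, with equality exactly when the vector is a
factorization of that coset in `N'` (`IsInteriorPoint.factHom_cases`). As `N'` is staircase, each
coset has a unique lightest vector, its standard vector, and by refinement this is also a
factorization in `N` (`exists_isDegeneration`). The corners, i.e. the minimal non-standard vectors,
are minimal factorizations of `∞` in `N'`, and each of those alone is an outer Betti element of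
`N'`. So there are at most `β'` corners.

In `N`, rewriting each non-nil corner to the standard vector of its coset gives a presentation. A
minimal presentation is no larger than any other, because its relations are linearly independent
edges in a space spanned by the edges of any presentation (`IsMinimalPresentation.encard_le`). Each
outer Betti element of `N` contains a nil corner, its lightest vector, and distinct outer Betti
elements are disjoint. Hence `|ρ| + β` is at most the number of corners.

For numerical semigroups, all corners, nil or not, give relations of `S` once a multiple of `m` is
added to the standard side, and these present `S`. In `S'`, the lift of a minimal factorization of
`∞` is isolated among the factorizations of its value, so every presentation needs at least one
independent relation for each (`IsAperyProjection.encard_minimalNil_le`).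

A staircase `N'` exists because an interior point of the face of `N` can be perturbed by a generic
weight that singles out one factorization of each coset (`exists_staircase_refinement`). -/

theorem encard_le_of_linearIndepOn_of_subset_span {α β V : Type*} [AddCommGroup V] [Module ℚ V]
    {v : α → V} {w : β → V} {s : Set α} {t : Set β} (hv : LinearIndepOn ℚ v s)
    (hst : ∀ a ∈ s, v a ∈ span ℚ (w '' t)) : s.encard ≤ t.encard := by
  rcases t.finite_or_infinite with ht | ht
  · have := (ht.image w).to_subtype
    have := Fintype.ofFinite (w '' t)
    have h := linearIndependent_le_span' (fun a : s => v a) hv (w '' t)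
      (by rintro _ ⟨a, rfl⟩; exact hst a a.2)
    have h2 : s.encard ≤ (w '' t).encard := by
      have h3 := OrderHomClass.mono Cardinal.toENat h
      rwa [map_natCast, ← Set.toFinset_card, ← Set.encard_eq_coe_toFinset_card] at h3
    exact h2.trans (Set.encard_image_le _ _)
  · rw [ht.encard_eq]; exact le_top

variable {X : Type*} (R : X → X → Prop)

/-- The vector of an edge between two classes of a relation. -/
noncomputable def edgeVector (p : X × X) : Quot R →₀ ℚ :=
  Finsupp.single (Quot.mk R p.1) 1 - Finsupp.single (Quot.mk R p.2) 1

/-- Collapsing the edges of `σ` induces a linear map that kills their span, and basis vectors still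
separate the classes of the coarser quotient. Conversely, edge vectors telescope along a path. -/
theorem edgeVector_mem_span_iff (σ : Set (X × X)) (a b : X) :
    edgeVector R (a, b) ∈ span ℚ (edgeVector R '' σ) ↔
      Relation.EqvGen (fun a b => R a b ∨ (a, b) ∈ σ) a b := by
  constructor
  · intro h
    let f : Quot R → Quot (fun a b => R a b ∨ (a, b) ∈ σ) := Quot.map id fun _ _ => Or.inl
    have hf : ∀ a, f (Quot.mk R a) = Quot.mk _ a := fun _ => rfl
    have hker : span ℚ (edgeVector R '' σ) ≤ LinearMap.ker (Finsupp.lmapDomain ℚ ℚ f) := by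
      rw [span_le]
      rintro _ ⟨⟨c, d⟩, hcd, rfl⟩
      simp only [SetLike.mem_coe, LinearMap.mem_ker, edgeVector, map_sub,
        Finsupp.lmapDomain_apply, Finsupp.mapDomain_single, hf]
      rw [show Quot.mk (fun a b => R a b ∨ (a, b) ∈ σ) c = Quot.mk _ d from
        Quot.sound (Or.inr hcd), sub_self]
    have h0 := hker h
    simp only [LinearMap.mem_ker, edgeVector, map_sub, Finsupp.lmapDomain_apply,
      Finsupp.mapDomain_single, hf, sub_eq_zero] at h0
    exact Quot.eqvGen_exact (Finsupp.single_left_injective one_ne_zero h0)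
  · intro h
    induction h with
    | rel a b h =>
      rcases h with h | h
      · simp [edgeVector, Quot.sound h]
      · exact subset_span ⟨_, h, rfl⟩
    | refl a => simp [edgeVector]
    | symm a b _ ih =>
      have := neg_mem ih
      simpa [edgeVector] using this
    | trans a b c _ _ ih1 ih2 =>
      have := add_mem ih1 ih2
      simpa [edgeVector] using this

/-- A forest has independent edges: no edge has its endpoints joined by the others. -/
theorem linearIndepOn_edgeVector {ρ : Set (X × X)}
    (h : ∀ p ∈ ρ, ¬ Relation.EqvGen (fun a b => R a b ∨ (a, b) ∈ ρ \ {p}) p.1 p.2) :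
    LinearIndepOn ℚ (edgeVector R) ρ := by
  rw [linearIndepOn_iff_notMem_span]
  intro p hp hmem
  exact h p hp ((edgeVector_mem_span_iff R _ _ _).1 hmem)

end LinearAlgebra

/-! ### Presentations, and why minimal ones are smallest. -/

section Presentations

variable {N : Type*} [AddCommMonoid N]

theorem factHom_single (i : atoms N) (k : ℕ) : factHom N (Finsupp.single i k) = k • (i : N) := by
  simp [factHom]

/-- The relation between factorizations of one element that is implied by relations at smaller
elements or involves the nil element. -/
def FiberLink (a b : Fact N) : Prop :=
  (∃ (i : atoms N) (a' b' : Fact N), factHom N a' = factHom N b' ∧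
    a = a' + Finsupp.single i 1 ∧ b = b' + Finsupp.single i 1) ∨
  (factHom N a = factHom N b ∧ IsNil (factHom N a))

theorem FiberLink.factHom_eq {a b : Fact N} (h : FiberLink a b) :
    factHom N a = factHom N b := by
  rcases h with ⟨i, a', b', h, rfl, rfl⟩ | h
  · rw [map_add, map_add, h]
  · exact h.1

/-- The equivalence relation generated by `FiberLink` and a set of pairs. -/
def Linked (ρ : Set (Fact N × Fact N)) : Fact N → Fact N → Prop :=
  Relation.EqvGen fun a b => FiberLink a b ∨ (a, b) ∈ ρ

theorem Linked.factHom_eq {ρ : Set (Fact N × Fact N)}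
    (hρ : ∀ p ∈ ρ, factHom N p.1 = factHom N p.2) {a b : Fact N} (h : Linked ρ a b) :
    factHom N a = factHom N b := by
  induction h with
  | rel a b h =>
    rcases h with h | h
    · exact h.factHom_eq
    · exact hρ _ h
  | refl a => rfl
  | symm a b _ ih => exact ih.symm
  | trans a b c _ _ ih1 ih2 => exact ih1.trans ih2

/-- For `c ≠ 0` the translated vectors share an atom of `c`, so they are joined by a single
`FiberLink`, whatever the original chain was. -/
theorem Linked.add_right {ρ : Set (Fact N × Fact N)}
    (hρ : ∀ p ∈ ρ, factHom N p.1 = factHom N p.2) {a b : Fact N} (h : Linked ρ a b) (c : Fact N) :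
    Linked ρ (a + c) (b + c) := by
  by_cases hc : c = 0
  · simpa [hc] using h
  · obtain ⟨i, hi⟩ := Finsupp.support_nonempty_iff.2 hc
    obtain ⟨d, rfl⟩ : ∃ d, c = d + Finsupp.single i 1 := by
      refine ⟨c - Finsupp.single i 1, (tsub_add_cancel_of_le ?_).symm⟩
      rw [Finsupp.single_le_iff]
      exact Nat.one_le_iff_ne_zero.2 (Finsupp.mem_support_iff.1 hi)
    refine .rel _ _ (Or.inl (Or.inl ⟨i, a + d, b + d, ?_, by abel, by abel⟩))
    rw [map_add, map_add, h.factHom_eq hρ]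

theorem IsPresentation.factHom_eq {ρ : Set (Fact N × Fact N)} (h : IsPresentation N ρ) :
    ∀ p ∈ ρ, factHom N p.1 = factHom N p.2 := by
  obtain ⟨σ, hσ, rfl⟩ := h
  intro p hp
  have : AddCon.ker (factHom N) p.1 p.2 := by
    rw [← hσ]; exact AddConGen.Rel.of _ _ hp.1
  exact this

theorem IsPresentation.not_isNil {ρ : Set (Fact N × Fact N)} (h : IsPresentation N ρ) :
    ∀ p ∈ ρ, ¬ IsNil (factHom N p.1) := by
  obtain ⟨σ, hσ, rfl⟩ := h
  exact fun p hp => hp.2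

/-- By `Linked.add_right`, `Linked ρ` is a congruence. It contains all generators, the omitted ones
at nil through the second clause of `FiberLink`. -/
theorem IsPresentation.linked {ρ : Set (Fact N × Fact N)} (h : IsPresentation N ρ) {a b : Fact N}
    (hab : factHom N a = factHom N b) : Linked ρ a b := by
  have hρ := h.factHom_eq
  obtain ⟨σ, hσ, rfl⟩ := h
  have hσ' : ∀ p ∈ σ, factHom N p.1 = factHom N p.2 := fun p hp => by
    have : AddCon.ker (factHom N) p.1 p.2 := by
      rw [← hσ]; exact AddConGen.Rel.of _ _ hp
    exact this
  set ρ := {p ∈ σ | ¬ IsNil (factHom N p.1)} with hdef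
  let E : AddCon (Fact N) :=
    { r := Linked ρ
      iseqv := Relation.EqvGen.is_equivalence _
      add' := fun {a b c d} h1 h2 => by
        refine (h1.add_right hρ c).trans _ _ _ ?_
        rw [add_comm b c, add_comm b d]
        exact h2.add_right hρ b }
  have hle : addConGen (fun a b => (a, b) ∈ σ) ≤ E := by
    refine AddCon.addConGen_le.2 fun a b hab => ?_
    refine Relation.EqvGen.rel _ _ ?_
    by_cases hn : IsNil (factHom N a)
    · exact Or.inl (Or.inr ⟨hσ' _ hab, hn⟩)
    · exact Or.inr ⟨hab, hn⟩
  rw [hσ] at hle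
  exact hle hab

/-- Well-founded induction on the element: cancelling the shared atom of a link leaves a pair at a
strictly smaller element, already in the congruence. -/
theorem isPresentation_of_linked {r : N → N → Prop} (hr : WellFounded r)
    (hatom : ∀ p i : N, i ∈ atoms N → ¬ IsNil (p + i) → r p (p + i))
    {ρ : Set (Fact N × Fact N)} (hρ : ∀ p ∈ ρ, factHom N p.1 = factHom N p.2)
    (hnil : ∀ p ∈ ρ, ¬ IsNil (factHom N p.1))
    (h : ∀ a b, factHom N a = factHom N b → ¬ IsNil (factHom N a) → Linked ρ a b) :
    IsPresentation N ρ := by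
  set σ : Set (Fact N × Fact N) :=
    ρ ∪ {p | factHom N p.1 = factHom N p.2 ∧ IsNil (factHom N p.1)} with hσ
  refine ⟨σ, le_antisymm ?_ ?_, ?_⟩
  · refine AddCon.addConGen_le.2 fun a b hab => ?_
    rcases hab with hab | hab
    · exact hρ _ hab
    · exact hab.1
  · have key : ∀ p : N, ∀ a b : Fact N, factHom N a = p → factHom N b = p →
        addConGen (fun a b => (a, b) ∈ σ) a b := by
      intro p
      induction p using hr.induction with
      | _ p ih =>
      intro a b ha hb
      by_cases hp : IsNil p
      · exact AddConGen.Rel.of _ _ (Or.inr ⟨ha.trans hb.symm, by simpa [ha] using hp⟩)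
      have hlink := h a b (ha.trans hb.symm) (by rwa [ha])
      clear hb
      induction hlink with
      | rel a b hab =>
        rcases hab with (⟨i, a', b', hab, rfl, rfl⟩ | hab) | hab
        · refine (addConGen _).add (ih (factHom N a') ?_ a' b' rfl hab.symm) ((addConGen _).refl _)
          have := hatom (factHom N a') i i.2
          rw [map_add, factHom_single, one_smul] at ha
          rw [ha] at this
          exact this hp
        · exact absurd (ha ▸ hab.2) hp
        · exact AddConGen.Rel.of _ _ (Or.inl hab)
      | refl a => exact (addConGen _).refl _
      | symm a b hab ih' =>
        exact (addConGen _).symm (ih' ((Linked.factHom_eq hρ hab).trans ha))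
      | trans a b c hab _ ih1 ih2 =>
        exact (addConGen _).trans (ih1 ha) (ih2 ((Linked.factHom_eq hρ hab).symm.trans ha))
    exact fun a b hab => key _ a b hab rfl
  · ext p
    constructor
    · exact fun hp => ⟨Or.inl hp, hnil p hp⟩
    · rintro ⟨hp | hp, hn⟩
      · exact hp
      · exact absurd hp.2 hn

/-- Modulo `FiberLink`, presentations are spanning sets of edges. Minimality makes the edges of `ρ`
a forest, since a redundant edge could be dropped, and independent vectors in the span of `τ` number
at most `τ`. -/
theorem IsMinimalPresentation.encard_le {r : N → N → Prop} (hr : WellFounded r)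
    (hatom : ∀ p i : N, i ∈ atoms N → ¬ IsNil (p + i) → r p (p + i))
    {ρ τ : Set (Fact N × Fact N)} (hρ : IsMinimalPresentation N ρ) (hτ : IsPresentation N τ) :
    ρ.encard ≤ τ.encard := by
  refine encard_le_of_linearIndepOn_of_subset_span (v := edgeVector FiberLink)
    (w := edgeVector FiberLink) (linearIndepOn_edgeVector _ fun p hp hlink => ?_) fun p hp => ?_
  · have hpres : IsPresentation N (ρ \ {p}) := by
      refine isPresentation_of_linked hr hatom (fun q hq => hρ.prop.factHom_eq q hq.1)
        (fun q hq => hρ.prop.not_isNil q hq.1) fun a b hab _ => ?_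
      have := hρ.prop.linked hab
      induction this with
      | rel a b h =>
        rcases h with h | h
        · exact .rel _ _ (Or.inl h)
        · by_cases hpe : (a, b) = p
          · subst hpe; exact hlink
          · exact .rel _ _ (Or.inr ⟨h, hpe⟩)
      | refl a => exact .refl _
      | symm a b h ih =>
        have e := Linked.factHom_eq hρ.prop.factHom_eq h
        exact .symm _ _ (ih e (by rwa [e]))
      | trans a b c h1 h2 ih1 ih2 =>
        have e1 := Linked.factHom_eq hρ.prop.factHom_eq h1
        have e2 := Linked.factHom_eq hρ.prop.factHom_eq h2
        exact .trans _ _ _ (ih1 e1 ‹_›) (ih2 e2 (by rwa [← e1]))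
    exact (hρ.le_of_le hpres Set.sdiff_subset hp).2 rfl
  · exact (edgeVector_mem_span_iff _ _ _ _).2 (hτ.linked (hρ.prop.factHom_eq p hp))

end Presentations

end Kunz

namespace Kunz

variable {m : ℕ} {H : AddSubgroup (ZMod m)}

/-! ### Relative interior points of faces. -/

section Interior

/-- A point of the relative interior of a face, as a function on the cosets of the Kunz
subgroup. -/
structure IsInteriorPoint (F : KunzFace m H) (X : ZMod m ⧸ H → ℝ) : Prop where
  zero : X 0 = 0
  pos : ∀ q, q ≠ 0 → 0 < X q
  add_le : ∀ q r, X (q + r) ≤ X q + X r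
  tight_iff : ∀ q r, F.Tight q r ↔ X q + X r = X (q + r)

theorem IsInteriorPoint.nonneg {F : KunzFace m H} {X : ZMod m ⧸ H → ℝ} (hX : IsInteriorPoint F X)
    (q : ZMod m ⧸ H) : 0 ≤ X q := by
  by_cases h : q = 0
  · rw [h, hX.zero]
  · exact (hX.pos q h).le

theorem IsFace.sum_mem {F : Set (ZMod m → ℝ)} (hF : IsFace m F) {ι : Type*} (s : Finset ι)
    (f : ι → ZMod m → ℝ) (hf : ∀ i ∈ s, f i ∈ F) : ∑ i ∈ s, f i ∈ F := by
  obtain ⟨Z, T, -, rfl⟩ := hF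
  refine ⟨⟨?_, fun j => ?_, fun j k hj hk hjk => ?_⟩, fun j hj => ?_, fun p hp => ?_⟩
  · rw [Finset.sum_apply]; exact Finset.sum_eq_zero fun i hi => (hf i hi).1.1
  · rw [Finset.sum_apply]; exact Finset.sum_nonneg fun i hi => (hf i hi).1.2.1 j
  · simp only [Finset.sum_apply, ← Finset.sum_add_distrib]
    exact Finset.sum_le_sum fun i hi => (hf i hi).1.2.2 j k hj hk hjk
  · rw [Finset.sum_apply]; exact Finset.sum_eq_zero fun i hi => (hf i hi).2.1 j hj
  · simp only [Finset.sum_apply, ← Finset.sum_add_distrib]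
    exact Finset.sum_congr rfl fun i hi => (hf i hi).2.2 p hp

/-- Add up one witness of strictness for each coordinate outside `H` and each non-tight pair. Slack
is nonnegative on the whole face, so it survives in the finite sum. -/
theorem exists_isInteriorPoint [NeZero m] (F : KunzFace m H) :
    ∃ X : ZMod m ⧸ H → ℝ, IsInteriorPoint F X := by
  classical
  have zero_mem : (0 : ZMod m → ℝ) ∈ F.carrier := by
    simpa using F.isFace.sum_mem (∅ : Finset ℕ) (fun _ => 0) (by simp)
  have h1 : ∀ a : ZMod m, ∃ x ∈ F.carrier, a ∉ H → 0 < x a := by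
    intro a
    by_cases ha : a ∈ H
    · exact ⟨0, zero_mem, fun h => absurd ha h⟩
    · have := mt (F.mem_subgroup a).2 ha
      push Not at this
      obtain ⟨-, x, hx, hxa⟩ := this
      exact ⟨x, hx, fun _ => lt_of_le_of_ne ((F.isFace.mem_cone hx).2.1 a) (Ne.symm hxa)⟩
  have h2 : ∀ p : ZMod m × ZMod m, ∃ x ∈ F.carrier, ¬ F.Tight (p.1 : ZMod m ⧸ H) p.2 →
      x (p.1 + p.2) < x p.1 + x p.2 := by
    intro p
    by_cases hp : F.Tight (p.1 : ZMod m ⧸ H) p.2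
    · exact ⟨0, zero_mem, fun h => absurd hp h⟩
    · have := hp
      rw [F.tight_mk] at this
      push Not at this
      obtain ⟨x, hx, hxa⟩ := this
      exact ⟨x, hx, fun _ => lt_of_le_of_ne (kunzCone_add_le (F.isFace.mem_cone hx) _ _)
        (Ne.symm hxa)⟩
  choose f hfF hf using h1
  choose g hgF hg using h2
  set x : ZMod m → ℝ := ∑ a, f a + ∑ p, g p with hx
  have hs1 := F.isFace.sum_mem Finset.univ f fun a _ => hfF a
  have hs2 := F.isFace.sum_mem Finset.univ g fun a _ => hgF a
  have hxF : x ∈ F.carrier := by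
    have := F.isFace.sum_mem (Finset.univ : Finset Bool)
      (fun b => if b then ∑ a, f a else ∑ p, g p) (by intro b _; cases b <;> simpa)
    simpa [hx] using this
  have hmk : ∀ a : ZMod m, x (a : ZMod m ⧸ H).out = x a := fun a =>
    F.eq_of_mk_eq (Quotient.out_eq _) hxF
  have hcone := F.isFace.mem_cone hxF
  refine ⟨fun q => x q.out, ?_, ?_, ?_, ?_⟩
  · rw [← QuotientAddGroup.mk_zero, hmk, hcone.1]
  · intro q hq
    induction q using QuotientAddGroup.induction_on with | H a
    rw [hmk]
    have ha : a ∉ H := fun h => hq ((QuotientAddGroup.eq_zero_iff a).2 h)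
    have l1 : 0 < (∑ a, f a) a := by
      rw [Finset.sum_apply]
      exact (hf a ha).trans_le (Finset.single_le_sum (f := fun b => f b a)
        (fun b _ => (F.isFace.mem_cone (hfF b)).2.1 a) (Finset.mem_univ a))
    have l2 := (F.isFace.mem_cone hs2).2.1 a
    rw [hx, Pi.add_apply]
    linarith
  · intro q r
    induction q using QuotientAddGroup.induction_on with | H a
    induction r using QuotientAddGroup.induction_on with | H b
    simp only [← QuotientAddGroup.mk_add, hmk]
    exact kunzCone_add_le hcone a b
  · intro q r
    induction q using QuotientAddGroup.induction_on with | H a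
    induction r using QuotientAddGroup.induction_on with | H b
    simp only [← QuotientAddGroup.mk_add, hmk]
    constructor
    · intro h
      exact (F.tight_mk a b).1 h x hxF
    · contrapose
      intro h
      have l1 := kunzCone_add_le (F.isFace.mem_cone hs1) a b
      have l2 : (∑ p, g p) (a + b) < (∑ p, g p) a + (∑ p, g p) b := by
        simp only [Finset.sum_apply, ← Finset.sum_add_distrib]
        exact Finset.sum_lt_sum (fun p _ => kunzCone_add_le (F.isFace.mem_cone (hgF p)) a b)
          ⟨(a, b), Finset.mem_univ _, hg (a, b) h⟩
      rw [hx]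
      simp only [Pi.add_apply]
      intro h
      linarith

/-- The face is cut out by all equalities that hold at `Y`. Since `Y` lies on it, no further
relation can hold on all of it. -/
theorem exists_kunzFace_of_subadditive {Y : ZMod m ⧸ H → ℝ} (h0 : Y 0 = 0)
    (hpos : ∀ q, q ≠ 0 → 0 < Y q) (hadd : ∀ q r, Y (q + r) ≤ Y q + Y r) :
    ∃ F : KunzFace m H, IsInteriorPoint F Y := by
  have hnn : ∀ q, 0 ≤ Y q := fun q => by
    by_cases h : q = 0
    · rw [h, h0]
    · exact (hpos q h).le
  let y : ZMod m → ℝ := fun a => Y a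
  let T : Set (ZMod m × ZMod m) :=
    {p | p.1 ≠ 0 ∧ p.2 ≠ 0 ∧ p.1 + p.2 ≠ 0 ∧ y p.1 + y p.2 = y (p.1 + p.2)}
  let C : Set (ZMod m → ℝ) :=
    {x ∈ kunzCone m | (∀ i ∈ (H : Set (ZMod m)), x i = 0) ∧
      ∀ p ∈ T, x p.1 + x p.2 = x (p.1 + p.2)}
  have hyH : ∀ a, y a = 0 ↔ a ∈ H := by
    intro a
    rw [← QuotientAddGroup.eq_zero_iff]
    refine ⟨fun h => ?_, fun h => ?_⟩
    · by_contra hne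
      exact (hpos _ hne).ne' h
    · change Y a = 0
      rw [h, h0]
  have hyC : y ∈ C := by
    refine ⟨⟨(hyH 0).2 H.zero_mem, fun i => hnn _, fun i j _ _ _ => ?_⟩,
      fun i hi => (hyH i).2 hi, fun p hp => hp.2.2.2⟩
    exact hadd (i : ZMod m ⧸ H) j
  let F : KunzFace m H :=
    { carrier := C
      isFace := ⟨H, T, fun p hp => ⟨hp.1, hp.2.1, hp.2.2.1⟩, rfl⟩
      mem_subgroup := fun i => by
        constructor
        · exact fun hi => Or.inr fun x hx => hx.2.1 i hi
        · rintro (rfl | h)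
          · exact H.zero_mem
          · exact (hyH i).1 (h y hyC) }
  refine ⟨F, h0, hpos, hadd, fun q r => ?_⟩
  induction q using QuotientAddGroup.induction_on with | H a
  induction r using QuotientAddGroup.induction_on with | H b
  rw [F.tight_mk, ← QuotientAddGroup.mk_add]
  constructor
  · exact fun h => h y hyC
  · intro h x hx
    by_cases ha : a = 0
    · subst ha; rw [hx.1.1]; simp
    by_cases hb : b = 0
    · subst hb; rw [hx.1.1]; simp
    by_cases hab : a + b = 0
    -- The cone has no inequality for pairs of sum zero. Equality at `Y` then forces both values to
    -- vanish, so both indices lie in `H`.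
    · have e : y a + y b = 0 := by
        change Y a + Y b = 0
        rw [h, hab, QuotientAddGroup.mk_zero, h0]
      have ea : y a = 0 := le_antisymm (by linarith [hnn (b : ZMod m ⧸ H)]) (hnn _)
      have eb : y b = 0 := by linarith
      rw [hab, hx.1.1, hx.2.1 a ((hyH a).1 ea), hx.2.1 b ((hyH b).1 eb), add_zero]
    · exact hx.2.2 (a, b) ⟨ha, hb, hab, h⟩

end Interior

/-! ### Structure of Kunz nilsemigroups; factorizations detected by weight. -/

section KunzNil

variable {F : KunzFace m H}

open Classical in
theorem KunzNil.of_add_of (q r : ZMod m ⧸ H) :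
    (KunzNil.of q + KunzNil.of r : KunzNil F) =
      if F.Tight q r then KunzNil.of (q + r) else KunzNil.nil := rfl

theorem KunzNil.nil_add (a : KunzNil F) : KunzNil.nil + a = KunzNil.nil := rfl

theorem KunzNil.add_nil (a : KunzNil F) : a + KunzNil.nil = KunzNil.nil := by
  rw [add_comm, KunzNil.nil_add]

theorem KunzNil.zero_def : (0 : KunzNil F) = KunzNil.of 0 := rfl

theorem KunzNil.isNil_iff {a : KunzNil F} : IsNil a ↔ a = KunzNil.nil := by
  constructor
  · intro h; rw [← h KunzNil.nil, KunzNil.nil_add]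
  · rintro rfl b; exact KunzNil.add_nil b

theorem KunzNil.not_isNil_of (q : ZMod m ⧸ H) : ¬ IsNil (KunzNil.of q : KunzNil F) := by
  rw [KunzNil.isNil_iff]; exact nofun

/-- The coset underlying a non-nil element, with junk value `0` at the nil element. -/
def KunzNil.coset : KunzNil F → ZMod m ⧸ H
  | .nil => 0
  | .of q => q

theorem KunzNil.of_coset {a : KunzNil F} (h : ¬ IsNil a) : KunzNil.of a.coset = a := by
  cases a with
  | nil => exact absurd (KunzNil.isNil_iff.2 rfl) h
  | of q => rfl

theorem KunzNil.not_isNil_atom (i : atoms (KunzNil F)) : ¬ IsNil (i : KunzNil F) := by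
  obtain ⟨i, hi0, hi⟩ := i
  intro h
  obtain rfl := KunzNil.isNil_iff.1 h
  exact hi .nil .nil hi0 hi0 rfl

theorem KunzNil.of_coset_atom (i : atoms (KunzNil F)) : KunzNil.of (i : KunzNil F).coset = i.1 :=
  KunzNil.of_coset (KunzNil.not_isNil_atom i)

instance KunzNil.finite [NeZero m] : Finite (KunzNil F) := by
  refine Finite.of_injective (β := Option (ZMod m ⧸ H))
    (fun a => match a with | .nil => none | .of q => some q) ?_
  rintro (_ | a) (_ | b) h <;> simp_all

theorem KunzNil.tight_of_not_isNil {q r : ZMod m ⧸ H}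
    (h : ¬ IsNil (KunzNil.of q + KunzNil.of r : KunzNil F)) : F.Tight q r := by
  by_contra hn
  rw [KunzNil.of_add_of, if_neg hn] at h
  exact h (KunzNil.isNil_iff.2 rfl)

variable (F) in
theorem KunzNil.isPartlyCancellative : IsPartlyCancellative (KunzNil F) := by
  intro a b c habc hn
  have hn' := hn
  rw [habc] at hn'
  rcases a with _ | a
  · exact absurd (KunzNil.isNil_iff.2 (KunzNil.nil_add _)) hn
  rcases b with _ | b
  · exact absurd (KunzNil.isNil_iff.2 (KunzNil.add_nil _)) hn
  rcases c with _ | c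
  · exact absurd (KunzNil.isNil_iff.2 (KunzNil.add_nil _)) hn'
  rw [KunzNil.of_add_of, KunzNil.of_add_of, if_pos (KunzNil.tight_of_not_isNil hn),
    if_pos (KunzNil.tight_of_not_isNil hn')] at habc
  simpa using habc

theorem IsInteriorPoint.nsmul {X : ZMod m ⧸ H → ℝ} (hX : IsInteriorPoint F X) (q : ZMod m ⧸ H)
    (k : ℕ) : IsNil (k • (KunzNil.of q : KunzNil F)) ∨
      (k • (KunzNil.of q : KunzNil F) = KunzNil.of (k • q) ∧ X (k • q) = k * X q) := by
  induction k with
  | zero => right; simp [hX.zero, KunzNil.zero_def]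
  | succ k ih =>
    by_cases hn : IsNil ((k + 1) • (KunzNil.of q : KunzNil F))
    · exact Or.inl hn
    right
    rw [succ_nsmul] at hn
    rcases ih with h | ⟨h, hk⟩
    · rw [KunzNil.isNil_iff.1 h, KunzNil.nil_add] at hn
      exact absurd (KunzNil.isNil_iff.2 rfl) hn
    · rw [h] at hn
      have ht := KunzNil.tight_of_not_isNil hn
      rw [succ_nsmul, succ_nsmul, h, KunzNil.of_add_of, if_pos ht, ← (hX.tight_iff _ _).1 ht, hk]
      push_cast
      exact ⟨rfl, by ring⟩

-- The multiple by `m` works: if `m • q` were not nil, additivity of `X` would give `m * X q = X 0 =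
-- 0`, against positivity.
variable (F) in
theorem KunzNil.isNilsemigroup [NeZero m] : IsNilsemigroup (KunzNil F) := by
  refine ⟨⟨.nil, KunzNil.isNil_iff.2 rfl⟩, fun a ha => ⟨m, NeZero.one_le, ?_⟩⟩
  obtain ⟨X, hX⟩ := exists_isInteriorPoint F
  rcases a with _ | q
  · have h : ∀ k : ℕ, k ≠ 0 → k • (KunzNil.nil : KunzNil F) = KunzNil.nil := fun k hk => by
      obtain ⟨k, rfl⟩ := Nat.exists_eq_succ_of_ne_zero hk
      rw [succ_nsmul, KunzNil.add_nil]
    exact KunzNil.isNil_iff.2 (h m (NeZero.ne m))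
  · rcases hX.nsmul q m with h | ⟨-, h⟩
    · exact h
    · exfalso
      have hq : q ≠ 0 := by rintro rfl; exact ha rfl
      have h0 : m • q = 0 := by
        induction q using QuotientAddGroup.induction_on with | H a
        rw [← QuotientAddGroup.mk_nsmul]
        simp
      rw [h0, hX.zero] at h
      have := hX.pos q hq
      have hm : (0 : ℝ) < m := by exact_mod_cast NeZero.pos m
      nlinarith [mul_pos hm this]

variable (F) in
/-- The coset of a factorization. -/
noncomputable def cosetHom : Fact (KunzNil F) →+ ZMod m ⧸ H :=
  Finsupp.liftAddHom fun a => multiplesHom _ (a : KunzNil F).coset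

/-- The weight of a factorization, for a weight function on the cosets. -/
noncomputable def weightHom (F : KunzFace m H) (X : ZMod m ⧸ H → ℝ) : Fact (KunzNil F) →+ ℝ :=
  Finsupp.liftAddHom fun a => multiplesHom _ (X (a : KunzNil F).coset)

theorem cosetHom_single (i : atoms (KunzNil F)) :
    cosetHom F (Finsupp.single i 1) = (i : KunzNil F).coset := by simp [cosetHom]

theorem weightHom_single (X : ZMod m ⧸ H → ℝ) (i : atoms (KunzNil F)) :
    weightHom F X (Finsupp.single i 1) = X (i : KunzNil F).coset := by simp [weightHom]

theorem Fact.induction {N : Type*} [AddCommMonoid N] {P : Fact N → Prop} (z : Fact N) (h0 : P 0)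
    (hadd : ∀ z i, P z → P (z + Finsupp.single i 1)) : P z := by
  induction z using Finsupp.induction with
  | zero => exact h0
  | single_add i k z _ hk ih =>
    clear hk
    rw [add_comm]
    induction k with
    | zero => simpa using ih
    | succ k ihk => rw [Finsupp.single_add, ← add_assoc]; exact hadd _ _ ihk

/-- A sum becomes nil exactly at the first non-tight addition, where subadditivity is strict; later
additions cannot recover the loss. Being a factorization is thus a condition on weight and coset
alone. -/
theorem IsInteriorPoint.factHom_cases {X : ZMod m ⧸ H → ℝ} (hX : IsInteriorPoint F X)
    (z : Fact (KunzNil F)) :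
    (factHom _ z = KunzNil.of (cosetHom F z) ∧ weightHom F X z = X (cosetHom F z)) ∨
    (factHom _ z = KunzNil.nil ∧ X (cosetHom F z) < weightHom F X z) := by
  induction z using Fact.induction with
  | h0 => left; simp [hX.zero, KunzNil.zero_def]
  | hadd z i ih =>
    simp only [map_add, factHom_single, one_smul, cosetHom_single, weightHom_single]
    rw [← KunzNil.of_coset_atom i]
    change _ ∧ _ + X (i : KunzNil F).coset = X (_ + (i : KunzNil F).coset) ∨
      _ ∧ X (_ + (i : KunzNil F).coset) < _ + X (i : KunzNil F).coset
    have hle := hX.add_le (cosetHom F z) (i : KunzNil F).coset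
    have hti := hX.tight_iff (cosetHom F z) (i : KunzNil F).coset
    rcases ih with ⟨h1, h2⟩ | ⟨h1, h2⟩
    · rw [h1, h2, KunzNil.of_add_of]
      by_cases ht : F.Tight (cosetHom F z) (i : KunzNil F).coset
      · rw [if_pos ht]
        exact Or.inl ⟨rfl, hti.1 ht⟩
      · rw [if_neg ht]
        exact Or.inr ⟨rfl, lt_of_le_of_ne hle fun h => ht (hti.2 h.symm)⟩
    · rw [h1, KunzNil.nil_add]
      exact Or.inr ⟨rfl, by linarith⟩

theorem IsInteriorPoint.le_weightHom {X : ZMod m ⧸ H → ℝ} (hX : IsInteriorPoint F X)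
    (z : Fact (KunzNil F)) : X (cosetHom F z) ≤ weightHom F X z := by
  rcases hX.factHom_cases z with h | h
  · exact h.2.ge
  · exact h.2.le

theorem IsInteriorPoint.factHom_eq_of_iff {X : ZMod m ⧸ H → ℝ} (hX : IsInteriorPoint F X)
    {z : Fact (KunzNil F)} {q : ZMod m ⧸ H} :
    factHom _ z = KunzNil.of q ↔ cosetHom F z = q ∧ weightHom F X z = X q := by
  rcases hX.factHom_cases z with ⟨h1, h2⟩ | ⟨h1, h2⟩
  · rw [h1, KunzNil.of.injEq]
    constructor
    · rintro rfl; exact ⟨rfl, h2⟩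
    · exact And.left
  · rw [h1]
    constructor
    · exact nofun
    · rintro ⟨rfl, h⟩; exact absurd h h2.ne'

theorem KunzNil.atom_coset_ne_zero (i : atoms (KunzNil F)) : (i : KunzNil F).coset ≠ 0 := by
  intro h
  have := KunzNil.of_coset_atom i
  rw [h] at this
  exact i.2.1 this.symm

/-- The order of the non-nil elements by weight is compatible with adding atoms. -/
theorem IsInteriorPoint.wellFounded [NeZero m] {X : ZMod m ⧸ H → ℝ} (hX : IsInteriorPoint F X) :
    ∃ r : KunzNil F → KunzNil F → Prop, WellFounded r ∧
      ∀ p i : KunzNil F, i ∈ atoms (KunzNil F) → ¬ IsNil (p + i) → r p (p + i) := by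
  refine ⟨fun p q => X p.coset < X q.coset, ?_, fun p i hi hn => ?_⟩
  · have : IsTrans (KunzNil F) fun p q => X p.coset < X q.coset := ⟨fun _ _ _ h h' => h.trans h'⟩
    have : Std.Irrefl (α := KunzNil F) fun p q => X p.coset < X q.coset := ⟨fun _ => lt_irrefl _⟩
    exact Finite.wellFounded_of_trans_of_irrefl _
  · have hi' : KunzNil.of i.coset = i := KunzNil.of_coset_atom ⟨i, hi⟩
    have hi0 : i.coset ≠ 0 := KunzNil.atom_coset_ne_zero ⟨i, hi⟩
    rcases p with _ | p
    · exact absurd (KunzNil.isNil_iff.2 (KunzNil.nil_add _)) hn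
    · rw [← hi'] at hn ⊢
      have ht := KunzNil.tight_of_not_isNil hn
      rw [KunzNil.of_add_of, if_pos ht]
      change X p < X (p + _)
      rw [← (hX.tight_iff _ _).1 ht]
      linarith [hX.pos _ hi0]

end KunzNil

end Kunz

namespace Kunz

variable {m : ℕ} {H : AddSubgroup (ZMod m)}

/-! ### Nonnegative weights on exponent vectors. -/

section Weights

variable {ι : Type*}

theorem exists_eq_add_single {z : ι →₀ ℕ} {i : ι} (h : i ∈ z.support) :
    z = z - Finsupp.single i 1 + Finsupp.single i 1 := by
  refine (tsub_add_cancel_of_le ?_).symm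
  rw [Finsupp.single_le_iff]
  exact Nat.one_le_iff_ne_zero.2 (Finsupp.mem_support_iff.1 h)

theorem weight_nonneg {w : (ι →₀ ℕ) →+ ℝ} (hw : ∀ i, 0 ≤ w (Finsupp.single i 1)) (z : ι →₀ ℕ) :
    0 ≤ w z := by
  induction z using Finsupp.induction with
  | zero => simp
  | single_add i k z _ _ ih =>
    rw [map_add]
    refine add_nonneg ?_ ih
    have : Finsupp.single i k = k • Finsupp.single i 1 := by simp
    rw [this, map_nsmul]
    exact nsmul_nonneg (hw i) k

/-- Dickson's lemma: an infinite descending sequence would contain an earlier term below a later one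
coordinatewise, hence of no greater weight. -/
theorem wellFounded_weight [Finite ι] {w : (ι →₀ ℕ) →+ ℝ}
    (hw : ∀ i, 0 ≤ w (Finsupp.single i 1)) : WellFounded fun a b => w a < w b := by
  have : IsStrictOrder (ι →₀ ℕ) fun a b => w a < w b :=
    { irrefl := fun _ => lt_irrefl _, trans := fun _ _ _ h h' => h.trans h' }
  rw [RelEmbedding.wellFounded_iff_isEmpty]
  refine ⟨fun f => ?_⟩
  obtain ⟨i, j, hij, hle⟩ := (wellQuasiOrdered_le (α := ι →₀ ℕ)) f
  have h1 : w (f j) < w (f i) := f.map_rel_iff.2 hij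
  obtain ⟨c, hc⟩ := exists_add_of_le hle
  rw [hc, map_add] at h1
  linarith [weight_nonneg hw c]

end Weights

/-! ### Standard vectors, corners, and the bound on `|ρ| + β`. -/

section Degeneration

variable {F : KunzFace m H}

/-- A choice of a standard factorization for every non-nil element of the Kunz nilsemigroup, such
that the standard factorization is the unique vector of least weight in its coset. -/
structure IsDegeneration (w : Fact (KunzNil F) →+ ℝ) (st : ZMod m ⧸ H → Fact (KunzNil F)) :
    Prop where
  factHom_st : ∀ q, factHom _ (st q) = KunzNil.of q
  nonneg : ∀ i, 0 ≤ w (Finsupp.single i 1)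
  lt : ∀ z, z ≠ st (cosetHom F z) → w (st (cosetHom F z)) < w z

/-- The minimal non-standard vectors. -/
def corners (st : ZMod m ⧸ H → Fact (KunzNil F)) : Set (Fact (KunzNil F)) :=
  {u | u ∉ Set.range st ∧ ∀ i ∈ u.support, u - Finsupp.single i 1 ∈ Set.range st}

theorem cosetHom_eq_of_factHom_eq [NeZero m] {z : Fact (KunzNil F)} {q : ZMod m ⧸ H}
    (h : factHom _ z = KunzNil.of q) : cosetHom F z = q := by
  obtain ⟨X, hX⟩ := exists_isInteriorPoint F
  exact (hX.factHom_eq_of_iff.1 h).1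

variable {w : Fact (KunzNil F) →+ ℝ} {st : ZMod m ⧸ H → Fact (KunzNil F)}

namespace IsDegeneration

theorem cosetHom_st [NeZero m] (hd : IsDegeneration w st) (q : ZMod m ⧸ H) :
    cosetHom F (st q) = q := cosetHom_eq_of_factHom_eq (hd.factHom_st q)

theorem mem_range_iff [NeZero m] (hd : IsDegeneration w st) {z : Fact (KunzNil F)} :
    z ∈ Set.range st ↔ st (cosetHom F z) = z := by
  constructor
  · rintro ⟨q, rfl⟩; rw [hd.cosetHom_st]
  · exact fun h => ⟨_, h⟩

theorem not_isNil_st (hd : IsDegeneration w st) (q : ZMod m ⧸ H) : ¬ IsNil (factHom _ (st q)) := by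
  rw [hd.factHom_st]; exact KunzNil.not_isNil_of q

theorem exists_corner_add {z : Fact (KunzNil F)}
    (hz : z ∉ Set.range st) : ∃ u ∈ corners st, ∃ c, z = u + c := by
  obtain ⟨u, ⟨huz, hu⟩, hmin⟩ := (wellFounded_lt (α := Fact (KunzNil F))).has_min
    {u | u ≤ z ∧ u ∉ Set.range st} ⟨z, le_rfl, hz⟩
  refine ⟨u, ⟨hu, fun i hi => ?_⟩, exists_add_of_le huz⟩
  by_contra hn
  refine hmin _ ⟨tsub_le_self.trans huz, hn⟩ (lt_of_le_of_ne tsub_le_self fun h => ?_)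
  have := DFunLike.congr_fun h i
  have h0 := Finsupp.mem_support_iff.1 hi
  simp at this
  omega

theorem weight_rewrite_lt (hd : IsDegeneration w st) {u : Fact (KunzNil F)}
    (hu : u ∈ corners st) (c : Fact (KunzNil F)) : w (st (cosetHom F u) + c) < w (u + c) := by
  rw [map_add, map_add]
  have := hd.lt u fun h => hu.1 ⟨_, h.symm⟩
  linarith

theorem cosetHom_rewrite [NeZero m] (hd : IsDegeneration w st) (u c : Fact (KunzNil F)) :
    cosetHom F (st (cosetHom F u) + c) = cosetHom F (u + c) := by
  rw [map_add, map_add, hd.cosetHom_st]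

/-- Replacing a corner inside a non-standard vector keeps the coset and lowers the weight, so
rewriting ends at the standard vector. Below a non-nil vector only non-nil corners occur. -/
theorem isPresentation [NeZero m] (hd : IsDegeneration w st) : IsPresentation (KunzNil F)
    ((fun u => (u, st (cosetHom F u))) '' {u ∈ corners st | ¬ IsNil (factHom _ u)}) := by
  set τ := (fun u => (u, st (cosetHom F u))) '' {u ∈ corners st | ¬ IsNil (factHom _ u)} with hτ
  obtain ⟨X, hX⟩ := exists_isInteriorPoint F
  obtain ⟨r, hr, hatom⟩ := hX.wellFounded
  have heq : ∀ {z : Fact (KunzNil F)}, ¬ IsNil (factHom _ z) →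
      factHom _ z = KunzNil.of (cosetHom F z) := fun {z} hz => by
    rcases hX.factHom_cases z with h | h
    · exact h.1
    · exact absurd (KunzNil.isNil_iff.2 h.1) hz
  have hker : ∀ p ∈ τ, factHom _ p.1 = factHom _ p.2 := by
    rintro _ ⟨u, hu, rfl⟩
    change factHom _ u = factHom _ (st _)
    rw [hd.factHom_st, heq hu.2]
  have key : ∀ z : Fact (KunzNil F), ¬ IsNil (factHom _ z) → Linked τ z (st (cosetHom F z)) := by
    intro z
    induction z using (wellFounded_weight hd.nonneg).induction with
    | _ z ih =>
    intro hz
    by_cases hzr : z ∈ Set.range st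
    · rw [hd.mem_range_iff.1 hzr]; exact .refl _
    obtain ⟨u, hu, c, rfl⟩ := exists_corner_add hzr
    have hun : ¬ IsNil (factHom _ u) := by
      intro h
      rw [map_add, KunzNil.isNil_iff.1 h, KunzNil.nil_add] at hz
      exact hz (KunzNil.isNil_iff.2 rfl)
    have h1 : Linked τ (u + c) (st (cosetHom F u) + c) :=
      Linked.add_right hker (.rel _ _ (Or.inr ⟨u, ⟨hu, hun⟩, rfl⟩)) c
    refine h1.trans _ _ _ ?_
    rw [← hd.cosetHom_rewrite u c]
    refine ih _ (hd.weight_rewrite_lt hu c) ?_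
    rwa [← h1.factHom_eq hker]
  refine isPresentation_of_linked hr hatom hker ?_ fun a b hab ha => ?_
  · rintro _ ⟨u, hu, rfl⟩; exact hu.2
  · have hb : ¬ IsNil (factHom _ b) := hab ▸ ha
    have h1 := key a ha
    have h2 := key b hb
    have hc : cosetHom F a = cosetHom F b := by
      rw [heq ha, heq hb] at hab
      simpa using hab
    rw [hc] at h1
    exact h1.trans _ _ _ (h2.symm _ _)

theorem encard_minimalPresentation_le [NeZero m] (hd : IsDegeneration w st)
    {ρ : Set (Fact (KunzNil F) × Fact (KunzNil F))} (hρ : IsMinimalPresentation (KunzNil F) ρ) :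
    ρ.encard ≤ {u ∈ corners st | ¬ IsNil (factHom _ u)}.encard := by
  obtain ⟨X, hX⟩ := exists_isInteriorPoint F
  obtain ⟨r, hr, hatom⟩ := hX.wellFounded
  exact (hρ.encard_le hr hatom hd.isPresentation).trans (Set.encard_image_le _ _)

/-- Take a lightest `u` in `B`. If `u - e_i` were not standard, the lighter standard vector of the
same element would also lie in `B - e_i`, and adding `e_i` back would give a lighter member of `B`.
-/
theorem exists_corner_mem_outerBetti [NeZero m] (hd : IsDegeneration w st)
    {B : Set (Fact (KunzNil F))} (hB : B ∈ outerBettiElements (KunzNil F)) :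
    ∃ u ∈ B, u ∈ corners st ∧ IsNil (factHom _ u) := by
  obtain ⟨hnil, hsub, hconn⟩ := hB
  obtain ⟨z, hz⟩ := hconn.nonempty
  obtain ⟨u, hu, hmin⟩ := (wellFounded_weight hd.nonneg).has_min B ⟨z, hz⟩
  refine ⟨u, hu, ⟨fun ⟨q, hq⟩ => hd.not_isNil_st q (hq ▸ hnil u hu), fun i hi => ?_⟩, hnil u hu⟩
  by_contra hr
  obtain ⟨p, hp, hpB⟩ := hsub i ⟨u, hu, hi⟩
  have h1 : u - Finsupp.single i 1 ∈ factorizations p := hpB ▸ ⟨u, ⟨hu, hi⟩, rfl⟩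
  have h1c : factHom _ (u - Finsupp.single i 1) = KunzNil.of p.coset :=
    h1.trans (KunzNil.of_coset hp).symm
  have h2 : st p.coset ∈ subUnit B i := by
    rw [hpB]
    exact (hd.factHom_st _).trans (KunzNil.of_coset hp)
  obtain ⟨z, ⟨hz, hzi⟩, hzu⟩ := h2
  refine hmin z hz ?_
  have hlt := hd.lt (u - Finsupp.single i 1) fun h => hr ⟨_, h.symm⟩
  rw [cosetHom_eq_of_factHom_eq h1c, ← hzu] at hlt
  rw [exists_eq_add_single hi, exists_eq_add_single hzi, map_add, map_add]
  simpa using hlt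

end IsDegeneration

/-- A shared vector and a common atom `i` make `B - e_i` and `B' - e_i` factorization sets of the
same element, so membership in `B'` spreads along the edges of the connected graph on `B`. -/
theorem subset_of_mem_outerBettiElements {N : Type*} [AddCommMonoid N] {B B' : Set (Fact N)}
    (hB : B ∈ outerBettiElements N) (hB' : B' ∈ outerBettiElements N) {u : Fact N}
    (hu : u ∈ B) (hu' : u ∈ B') : B ⊆ B' := by
  intro z hz
  obtain ⟨W⟩ := hB.2.2.preconnected ⟨u, hu⟩ ⟨z, hz⟩
  have key : ∀ {x y : B}, (factGraph B).Walk x y → x.1 ∈ B' → y.1 ∈ B' := by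
    intro x y W
    induction W with
    | nil => exact id
    | @cons x y t h W ih =>
      intro hx
      refine ih ?_
      obtain ⟨-, i, hix, hiy⟩ := h
      obtain ⟨p, -, hp⟩ := hB.2.1 i ⟨x, x.2, hix⟩
      obtain ⟨p', -, hp'⟩ := hB'.2.1 i ⟨x, hx, hix⟩
      have e1 : x.1 - Finsupp.single i 1 ∈ factorizations p := hp ▸ ⟨x, ⟨x.2, hix⟩, rfl⟩
      have e2 : x.1 - Finsupp.single i 1 ∈ factorizations p' := hp' ▸ ⟨x, ⟨hx, hix⟩, rfl⟩
      have e3 : y.1 - Finsupp.single i 1 ∈ factorizations p := hp ▸ ⟨y, ⟨y.2, hiy⟩, rfl⟩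
      have hpp : p = p' := Eq.trans (Eq.symm e1) e2
      rw [hpp, ← hp'] at e3
      obtain ⟨z, ⟨hz, hzi⟩, hzy⟩ := e3
      rw [exists_eq_add_single hiy, ← hzy]
      change z - Finsupp.single i 1 + _ ∈ B'
      rwa [← exists_eq_add_single hzi]
  exact key W hu'

theorem IsDegeneration.encard_outerBettiElements_le [NeZero m] (hd : IsDegeneration w st) :
    (outerBettiElements (KunzNil F)).encard ≤
      {u ∈ corners st | IsNil (factHom _ u)}.encard := by
  classical
  choose! f hf using fun B (hB : B ∈ outerBettiElements (KunzNil F)) =>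
    hd.exists_corner_mem_outerBetti hB
  refine Set.encard_le_encard_of_injOn (f := f) (fun B hB => (hf B hB).2) fun B hB B' hB' h => ?_
  have h1 := (hf B hB).1
  have h2 := (hf B' hB').1
  rw [← h] at h2
  exact (subset_of_mem_outerBettiElements hB hB' h1 h2).antisymm
    (subset_of_mem_outerBettiElements hB' hB h2 h1)

theorem IsDegeneration.encard_add_encard_le [NeZero m] (hd : IsDegeneration w st)
    {ρ : Set (Fact (KunzNil F) × Fact (KunzNil F))} (hρ : IsMinimalPresentation (KunzNil F) ρ) :
    ρ.encard + (outerBettiElements (KunzNil F)).encard ≤ (corners st).encard := by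
  refine (add_le_add (hd.encard_minimalPresentation_le hρ) hd.encard_outerBettiElements_le).trans ?_
  rw [← Set.encard_union_eq]
  · refine Set.encard_le_encard ?_
    rintro u (hu | hu) <;> exact hu.1
  · exact Set.disjoint_left.2 fun u hu hu' => hu.2 hu'.2

end Degeneration

/-! ### Outer Betti elements of a staircase nilsemigroup. -/

section Staircase

variable {N : Type*} [AddCommMonoid N]

variable (N) in
/-- The minimal vectors among the factorizations of nil elements. -/
def minimalNil : Set (Fact N) :=
  {u | IsNil (factHom N u) ∧ ∀ i ∈ u.support, ¬ IsNil (factHom N (u - Finsupp.single i 1))}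

theorem IsStaircase.eq_of_factHom_eq (hN : IsStaircase N) {a b : Fact N}
    (h : factHom N a = factHom N b) (ha : ¬ IsNil (factHom N a)) : a = b :=
  (hN.2.2.2 _ ha).unique rfl h.symm

/-- Each minimal factorization of nil forms a singleton outer Betti element: removing an atom leaves
a non-nil element with only that factorization. -/
theorem IsStaircase.encard_minimalNil_le (hN : IsStaircase N) :
    (minimalNil N).encard ≤ (outerBettiElements N).encard := by
  refine Set.encard_le_encard_of_injOn (f := fun u => {u}) (fun u hu => ⟨?_, ?_, ?_⟩)
    fun u _ v _ h => Set.singleton_injective h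
  · rintro z rfl; exact hu.1
  · rintro i ⟨z, rfl, hi⟩
    refine ⟨_, hu.2 i hi, ?_⟩
    ext y
    constructor
    · rintro ⟨z', ⟨rfl, _⟩, rfl⟩; exact rfl
    · exact fun hy => ⟨z, ⟨rfl, hi⟩, hN.eq_of_factHom_eq (Eq.symm hy) (hu.2 i hi)⟩
  · have : Nonempty ({u} : Set (Fact N)) := ⟨⟨u, rfl⟩⟩
    exact { preconnected := fun a b => by rw [Subsingleton.elim a b] }

end Staircase

end Kunz

namespace Kunz

variable {m : ℕ} {H : AddSubgroup (ZMod m)}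

/-! ### A staircase coarsening is a degeneration. -/

section Refinement

variable {F F' : KunzFace m H}

theorem coset_relabel (a : KunzNil F') : (relabel F' F a).coset = a.coset := by
  cases a <;> rfl

theorem relabel_injective : Function.Injective (relabel F' F) := by
  rintro (_ | a) (_ | b) h <;> simp_all [relabel]

/-- The bijection between the atoms of two Kunz nilsemigroups with the same atoms. -/
noncomputable def atomsEquiv (h : SameAtoms F F') : atoms (KunzNil F') ≃ atoms (KunzNil F) :=
  Equiv.ofBijective
    (fun a => ⟨relabel F' F a, h.subset (Set.mem_image_of_mem _ a.2)⟩)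
    ⟨fun _ _ hab => Subtype.ext (relabel_injective (congrArg Subtype.val hab)), fun b => by
      obtain ⟨a, ha, hab⟩ := h.superset b.2
      exact ⟨⟨a, ha⟩, Subtype.ext hab⟩⟩

theorem coe_atomsEquiv (h : SameAtoms F F') (a : atoms (KunzNil F')) :
    (atomsEquiv h a : KunzNil F) = relabel F' F a := rfl

/-- The induced bijection between exponent vectors. -/
noncomputable def factEquiv (h : SameAtoms F F') : Fact (KunzNil F') ≃+ Fact (KunzNil F) :=
  Finsupp.domCongr (atomsEquiv h)

theorem factEquiv_single (h : SameAtoms F F') (i : atoms (KunzNil F')) :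
    factEquiv h (Finsupp.single i 1) = Finsupp.single (atomsEquiv h i) 1 := by
  simp [factEquiv]

theorem cosetHom_factEquiv (h : SameAtoms F F') (z : Fact (KunzNil F')) :
    cosetHom F (factEquiv h z) = cosetHom F' z := by
  induction z using Fact.induction with
  | h0 => simp
  | hadd z i ih =>
    rw [map_add, map_add, map_add, ih, factEquiv_single, cosetHom_single, cosetHom_single,
      coe_atomsEquiv, coset_relabel]

theorem weightHom_factEquiv (h : SameAtoms F F') (X : ZMod m ⧸ H → ℝ) (z : Fact (KunzNil F')) :
    weightHom F X (factEquiv h z) = weightHom F' X z := by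
  induction z using Fact.induction with
  | h0 => simp
  | hadd z i ih =>
    rw [map_add, map_add, map_add, ih, factEquiv_single, weightHom_single, weightHom_single,
      coe_atomsEquiv, coset_relabel]

theorem mapDomain_factEquiv (h : SameAtoms F F') (z : Fact (KunzNil F')) :
    (factEquiv h z).mapDomain Subtype.val = z.mapDomain fun a => relabel F' F a.1 := by
  rw [factEquiv, Finsupp.domCongr_apply, Finsupp.equivMapDomain_eq_mapDomain,
    ← Finsupp.mapDomain_comp]
  rfl

theorem refines_iff (h : SameAtoms F F') : Refines F F' ↔
    ∀ q z, factHom (KunzNil F') z = KunzNil.of q →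
      factHom (KunzNil F) (factEquiv h z) = KunzNil.of q := by
  constructor
  · intro href q z hz
    obtain ⟨y, hy, hyz⟩ := href q ⟨z, hz, rfl⟩
    change y.mapDomain Subtype.val = z.mapDomain _ at hyz
    rw [← mapDomain_factEquiv h] at hyz
    rwa [← Finsupp.mapDomain_injective Subtype.val_injective hyz]
  · rintro H q _ ⟨z, hz, rfl⟩
    exact ⟨factEquiv h z, H q z hz, mapDomain_factEquiv h z⟩

/-- The weight comes from an interior point of the face of `N'`, and the standard vectors are the
unique factorizations in `N'`. Non-standard then means nil in `N'`, so corners become minimal nil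
vectors. -/
theorem exists_isDegeneration [NeZero m] (hs : IsStaircase (KunzNil F')) (h : SameAtoms F F')
    (href : Refines F F') :
    ∃ (w : Fact (KunzNil F) →+ ℝ) (st : ZMod m ⧸ H → Fact (KunzNil F)),
      IsDegeneration w st ∧ (corners st).encard ≤ (minimalNil (KunzNil F')).encard := by
  obtain ⟨X, hX⟩ := exists_isInteriorPoint F'
  rw [refines_iff h] at href
  choose s hs1 hs2 using fun q : ZMod m ⧸ H => hs.2.2.2 (.of q) (KunzNil.not_isNil_of q)
  have hs1' : ∀ q, factHom _ (s q) = KunzNil.of q := hs1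
  have hs2' : ∀ q z, factHom _ z = KunzNil.of q → z = s q := hs2
  have hw : ∀ q, weightHom F X (factEquiv h (s q)) = X q := fun q => by
    rw [weightHom_factEquiv, (hX.factHom_eq_of_iff.1 (hs1' q)).2]
  have hmem : ∀ z : Fact (KunzNil F'), factEquiv h z ∈ Set.range (fun q => factEquiv h (s q)) ↔
      ¬ IsNil (factHom _ z) := by
    intro z
    constructor
    · rintro ⟨q, hq⟩
      rw [← (factEquiv h).injective hq, hs1']
      exact KunzNil.not_isNil_of q
    · intro hz
      refine ⟨(factHom _ z).coset, ?_⟩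
      change factEquiv h (s _) = _
      rw [← hs2' _ z (KunzNil.of_coset hz).symm]
  refine ⟨weightHom F X, fun q => factEquiv h (s q), ⟨fun q => href q _ (hs1' q), fun i => ?_,
    fun z hz => ?_⟩, ?_⟩
  · rw [weightHom_single]; exact hX.nonneg _
  · obtain ⟨z, rfl⟩ := (factEquiv h).surjective z
    rw [hw, weightHom_factEquiv, cosetHom_factEquiv]
    rw [cosetHom_factEquiv] at hz
    -- Equal weight would make `z` a factorization in `N'`, hence the standard one by uniqueness.
    refine lt_of_le_of_ne (hX.le_weightHom z) fun he => hz ?_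
    rw [← hs2' _ z (hX.factHom_eq_of_iff.2 ⟨rfl, he.symm⟩)]
  · refine Set.encard_le_encard_of_injOn (f := (factEquiv h).symm) (fun u hu => ?_)
      (factEquiv h).symm.injective.injOn
    obtain ⟨v, rfl⟩ := (factEquiv h).surjective u
    rw [AddEquiv.symm_apply_apply]
    refine ⟨?_, fun i hi => ?_⟩
    · by_contra hn
      exact hu.1 ((hmem v).2 hn)
    · rw [← hmem]
      have e : factEquiv h v =
          factEquiv h (v - Finsupp.single i 1) + Finsupp.single (atomsEquiv h i) 1 := by
        rw [← factEquiv_single, ← map_add, ← exists_eq_add_single hi]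
      have := hu.2 (atomsEquiv h i) (by rw [e]; simp)
      rwa [e, add_tsub_cancel_right] at this

end Refinement

end Kunz

namespace Kunz

variable {m : ℕ} {H : AddSubgroup (ZMod m)}

/-! ### Presentations of numerical semigroups from their Kunz nilsemigroups. -/

section NumericalSemigroup

variable {S : AddSubmonoid ℕ}

theorem mem_apery_of_add_mem {a b : S} (h : a + b ∈ apery S m) : a ∈ apery S m := by
  by_contra ha
  exact not_mem_apery_add ha b h

theorem notMem_apery_iff {s : S} : s ∉ apery S m ↔ ∃ k : S, (s : ℕ) = k + m := by
  simp [apery]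

theorem zero_mem_apery [NeZero m] : (0 : S) ∈ apery S m := by
  intro k h
  have := NeZero.ne m
  simp at h
  omega

theorem exists_eq_apery_add_nsmul [NeZero m] (hm : m ∈ S) (s : S) :
    ∃ t ∈ apery S m, ∃ k : ℕ, s = t + k • ⟨m, hm⟩ := by
  obtain ⟨n, hn⟩ : ∃ n : ℕ, (s : ℕ) = n := ⟨_, rfl⟩
  induction n using Nat.strong_induction_on generalizing s with
  | _ n ih =>
  by_cases hs : s ∈ apery S m
  · exact ⟨s, hs, 0, by simp⟩
  · obtain ⟨k, hk⟩ := notMem_apery_iff.1 hs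
    have hm0 := NeZero.pos m
    obtain ⟨t, ht, j, hj⟩ := ih k (by omega) k rfl
    refine ⟨t, ht, j + 1, ?_⟩
    rw [succ_nsmul, ← add_assoc, ← hj]
    exact Subtype.ext hk

theorem factHom_surjective_of_submonoid (s : S) : ∃ z, factHom S z = s := by
  obtain ⟨n, hn⟩ : ∃ n : ℕ, (s : ℕ) = n := ⟨_, rfl⟩
  induction n using Nat.strong_induction_on generalizing s with
  | _ n ih =>
  by_cases h0 : s = 0
  · exact ⟨0, by rw [map_zero, h0]⟩
  by_cases hs : s ∈ atoms S
  · exact ⟨Finsupp.single ⟨s, hs⟩ 1, by rw [factHom_single, one_smul]⟩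
  · have : ∃ b c : S, b ≠ 0 ∧ c ≠ 0 ∧ s = b + c := by
      by_contra hcon
      push Not at hcon
      exact hs ⟨h0, fun b c hb hc => hcon b c hb hc⟩
    obtain ⟨b, c, hb, hc, rfl⟩ := this
    have hb' : (b : ℕ) ≠ 0 := fun h => hb (Subtype.ext h)
    have hc' : (c : ℕ) ≠ 0 := fun h => hc (Subtype.ext h)
    have hbc : (b : ℕ) + c = n := hn
    obtain ⟨y, hy⟩ := ih b (by omega) b rfl
    obtain ⟨z, hz⟩ := ih c (by omega) c rfl
    exact ⟨y + z, by rw [map_add, hy, hz]⟩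

theorem not_isNil_of_mem [NeZero m] (hm : m ∈ S) (s : S) : ¬ IsNil s := by
  intro h
  have h1 : m + (s : ℕ) = s := congrArg Subtype.val (h ⟨m, hm⟩)
  have := NeZero.ne m
  omega

theorem submonoid_wellFounded : WellFounded (fun s t : S => (s : ℕ) < t) ∧
    ∀ p i : S, i ∈ atoms S → ¬ IsNil (p + i) → (p : ℕ) < (p + i : S) := by
  refine ⟨InvImage.wf _ wellFounded_lt, fun p i hi _ => ?_⟩
  have : (i : ℕ) ≠ 0 := fun h => hi.1 (Subtype.ext h)
  change (p : ℕ) < p + i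
  omega

/-- The projection of `S` to its Kunz nilsemigroup, with the section on atoms that it induces. -/
structure IsAperyProjection (S : AddSubmonoid ℕ) {m : ℕ} {H : AddSubgroup (ZMod m)}
    (F : KunzFace m H) (e : S →+ KunzNil F) (a : atoms (KunzNil F) → atoms S) : Prop where
  of_mem : ∀ s ∈ apery S m, e s = KunzNil.of (((s : ℕ) : ZMod m) : ZMod m ⧸ H)
  of_notMem : ∀ s ∉ apery S m, e s = KunzNil.nil
  injOn : Set.InjOn e (apery S m)
  apply_section : ∀ i, e (a i) = i
  mem_range : ∀ s : atoms S, ((s : S) : ℕ) ≠ m → s ∈ Set.range a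

variable {F : KunzFace m H}

theorem IsKunzNilsemigroupOf.exists_projection [NeZero m] (hm : m ∈ S)
    (h : IsKunzNilsemigroupOf S F) : ∃ e a, IsAperyProjection S F e a := by
  obtain ⟨e, he⟩ := h
  let f : S →+ KunzNil F := e.toAddMonoidHom.comp (aperyCon S m).mk'
  have hf : ∀ s, f s = e (s : (aperyCon S m).Quotient) := fun s => rfl
  have hfsurj : Function.Surjective f := e.surjective.comp (AddCon.mk'_surjective)
  have h1 : ∀ s ∈ apery S m, f s = KunzNil.of (((s : ℕ) : ZMod m) : ZMod m ⧸ H) := he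
  have h2 : ∀ s ∉ apery S m, f s = KunzNil.nil := by
    intro s hs
    rw [← KunzNil.isNil_iff]
    intro b
    obtain ⟨t, rfl⟩ := hfsurj b
    rw [← map_add, hf, hf]
    congr 1
    refine (AddCon.eq _).2 (Or.inr ⟨?_, hs⟩)
    rw [add_comm]
    exact not_mem_apery_add hs t
  have hinj : Set.InjOn f (apery S m) := by
    intro s hs t ht hst
    rw [hf, hf] at hst
    rcases (AddCon.eq _).1 (e.injective hst) with h | h
    · exact h
    · exact absurd hs h.1
  have hmem : ∀ s, ¬ IsNil (f s) → s ∈ apery S m := fun s hs => by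
    by_contra hn
    exact hs (KunzNil.isNil_iff.2 (h2 s hn))
  have hzero : ∀ s ∈ apery S m, f s = 0 → s = 0 := fun s hs h0 =>
    hinj hs zero_mem_apery (h0.trans (map_zero f).symm)
  have hsec : ∀ i : atoms (KunzNil F), ∃ a : atoms S, f a = i := by
    intro i
    obtain ⟨s, hs⟩ := hfsurj i
    have hsA : s ∈ apery S m := hmem s (hs ▸ KunzNil.not_isNil_atom i)
    refine ⟨⟨s, ?_, fun b c hb hc hbc => ?_⟩, hs⟩
    · rintro rfl
      exact i.2.1 (hs.symm.trans (map_zero f))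
    · rw [hbc] at hsA
      have hbA := mem_apery_of_add_mem hsA
      have hcA := mem_apery_of_add_mem (add_comm b c ▸ hsA)
      refine i.2.2 (f b) (f c) (fun h => hb (hzero b hbA h)) (fun h => hc (hzero c hcA h)) ?_
      rw [← hs, hbc, map_add]
  choose a ha using hsec
  refine ⟨f, a, h1, h2, hinj, ha, fun s hsm => ?_⟩
  -- The only atom that can lie outside the Apéry set is `m` itself.
  have hsA : (s : S) ∈ apery S m := by
    by_contra hn
    obtain ⟨k, hk⟩ := notMem_apery_iff.1 hn
    refine s.2.2 k ⟨m, hm⟩ ?_ ?_ (Subtype.ext hk)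
    · rintro rfl
      exact hsm (by simpa using hk)
    · intro h
      exact NeZero.ne m (congrArg Subtype.val h)
  have hatom : f s ∈ atoms (KunzNil F) := by
    refine ⟨fun h => s.2.1 (hzero s hsA h), fun b c hb hc hbc => ?_⟩
    obtain ⟨b, rfl⟩ := hfsurj b
    obtain ⟨c, rfl⟩ := hfsurj c
    rw [← map_add] at hbc
    have hbcA : b + c ∈ apery S m := by
      refine hmem _ ?_
      rw [← hbc, h1 _ hsA]
      exact KunzNil.not_isNil_of _
    refine s.2.2 b c ?_ ?_ (hinj hsA hbcA hbc)
    · rintro rfl; exact hb (map_zero f)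
    · rintro rfl; exact hc (map_zero f)
  refine ⟨⟨f s, hatom⟩, Subtype.ext (hinj (hmem _ ?_) hsA (ha _))⟩
  rw [ha]
  exact KunzNil.not_isNil_atom _

namespace IsAperyProjection

variable {e : S →+ KunzNil F} {a : atoms (KunzNil F) → atoms S}

/-- Lift of an exponent vector along a map of atoms. -/
noncomputable def lift (a : atoms (KunzNil F) → atoms S) : Fact (KunzNil F) →+ Fact S :=
  Finsupp.mapDomain.addMonoidHom a

theorem lift_single (a : atoms (KunzNil F) → atoms S) (i : atoms (KunzNil F)) :
    lift a (Finsupp.single i 1) = Finsupp.single (a i) 1 := by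
  simp [lift]

theorem mem_apery (h : IsAperyProjection S F e a) {s : S} (hs : ¬ IsNil (e s)) :
    s ∈ apery S m := by
  by_contra hn
  exact hs (KunzNil.isNil_iff.2 (h.of_notMem s hn))

theorem section_mem_apery (h : IsAperyProjection S F e a) (i : atoms (KunzNil F)) :
    (a i : S) ∈ apery S m :=
  h.mem_apery (by rw [h.apply_section]; exact KunzNil.not_isNil_atom i)

theorem section_injective (h : IsAperyProjection S F e a) : Function.Injective a :=
  fun i j hij => Subtype.ext (by rw [← h.apply_section, hij, h.apply_section])

theorem lift_injective (h : IsAperyProjection S F e a) : Function.Injective (lift a) :=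
  Finsupp.mapDomain_injective h.section_injective

theorem apply_factHom_lift (h : IsAperyProjection S F e a) (z : Fact (KunzNil F)) :
    e (factHom S (lift a z)) = factHom _ z := by
  induction z using Fact.induction with
  | h0 => simp
  | hadd z i ih =>
    rw [map_add, map_add, map_add, map_add, ih, lift_single, factHom_single, factHom_single,
      one_smul, one_smul, h.apply_section]

/-- The coset of an element of a numerical semigroup. -/
def residue (H : AddSubgroup (ZMod m)) : S →+ ZMod m ⧸ H :=
  ((QuotientAddGroup.mk' H).comp (Nat.castAddMonoidHom (ZMod m))).comp S.subtype

theorem apply_eq_of_residue (h : IsAperyProjection S F e a) {s : S} (hs : s ∈ apery S m) :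
    e s = KunzNil.of (residue H s) := h.of_mem s hs

theorem residue_modulus (hm : m ∈ S) : residue H (⟨m, hm⟩ : S) = 0 := by
  change (((m : ℕ) : ZMod m) : ZMod m ⧸ H) = 0
  rw [ZMod.natCast_self, QuotientAddGroup.mk_zero]

theorem residue_factHom_lift (h : IsAperyProjection S F e a) (z : Fact (KunzNil F)) :
    residue H (factHom S (lift a z)) = cosetHom F z := by
  induction z using Fact.induction with
  | h0 => simp
  | hadd z i ih =>
    rw [map_add, map_add, map_add, map_add, ih, lift_single, factHom_single, one_smul,
      cosetHom_single]
    congr 1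
    have := h.apply_eq_of_residue (h.section_mem_apery i)
    rw [h.apply_section, ← KunzNil.of_coset_atom] at this
    simpa using this.symm

variable {w : Fact (KunzNil F) →+ ℝ} {st : ZMod m ⧸ H → Fact (KunzNil F)}

/-- Both sides have the same residue, and the standard vector evaluates to the unique Apéry element
of that class. -/
theorem exists_factHom_lift_eq [NeZero m] (h : IsAperyProjection S F e a)
    (hd : IsDegeneration w st) (hm : m ∈ S) (z : Fact (KunzNil F)) :
    ∃ k : ℕ, factHom S (lift a z) = factHom S (lift a (st (cosetHom F z))) + k • ⟨m, hm⟩ := by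
  obtain ⟨t, ht, k, hk⟩ := exists_eq_apery_add_nsmul hm (factHom S (lift a z))
  refine ⟨k, ?_⟩
  rw [hk]
  congr 1
  have hst : e (factHom S (lift a (st (cosetHom F z)))) = KunzNil.of (cosetHom F z) := by
    rw [h.apply_factHom_lift, hd.factHom_st]
  refine h.injOn ht (h.mem_apery (by rw [hst]; exact KunzNil.not_isNil_of _)) ?_
  rw [hst, h.apply_eq_of_residue ht, ← h.residue_factHom_lift, hk, map_add, map_nsmul,
    residue_modulus, nsmul_zero, add_zero]

/-- `m` need not be a minimal generator of `S`. Any factorization of it can play the role of the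
generator, provided it is the obvious one when `m` is an atom. -/
theorem exists_factorization_modulus (hm : m ∈ S) :
    ∃ f : Fact S, factHom S f = ⟨m, hm⟩ ∧
      ∀ s : atoms S, ((s : S) : ℕ) = m → f = Finsupp.single s 1 := by
  by_cases hma : (⟨m, hm⟩ : S) ∈ atoms S
  · refine ⟨Finsupp.single ⟨_, hma⟩ 1, by rw [factHom_single, one_smul], fun s hs => ?_⟩
    congr 1
    exact Subtype.ext (Subtype.ext hs.symm)
  · obtain ⟨f, hf⟩ := factHom_surjective_of_submonoid (⟨m, hm⟩ : S)
    refine ⟨f, hf, fun s hs => absurd ?_ hma⟩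
    have : (s : S) = ⟨m, hm⟩ := Subtype.ext hs
    exact this ▸ s.2

theorem exists_eq_lift_add (h : IsAperyProjection S F e a) {f : Fact S}
    (hf : ∀ s : atoms S, ((s : S) : ℕ) = m → f = Finsupp.single s 1) (y : Fact S) :
    ∃ z, ∃ j : ℕ, y = lift a z + j • f := by
  induction y using Fact.induction with
  | h0 => exact ⟨0, 0, by simp⟩
  | hadd y s ih =>
    obtain ⟨z, j, rfl⟩ := ih
    by_cases hs : ((s : S) : ℕ) = m
    · refine ⟨z, j + 1, ?_⟩
      rw [← hf s hs, succ_nsmul, add_assoc]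
    · obtain ⟨i, rfl⟩ := h.mem_range s hs
      refine ⟨z + Finsupp.single i 1, j, ?_⟩
      rw [map_add, lift_single]
      abel

/-- Each corner `u` gives the relation `u ~ st + k • f`, with `f` a factorization of `m`. Rewriting
yields normal forms `st q + j • f`, and these are determined by their value in `S`. -/
theorem encard_minimalPresentation_le [NeZero m] (h : IsAperyProjection S F e a)
    (hd : IsDegeneration w st) (hm : m ∈ S) {σ : Set (Fact S × Fact S)}
    (hσ : IsMinimalPresentation S σ) : σ.encard ≤ (corners st).encard := by
  obtain ⟨f, hfm, hf⟩ := exists_factorization_modulus hm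
  choose k hk using h.exists_factHom_lift_eq hd hm
  set τ : Set (Fact S × Fact S) :=
    (fun u => (lift a u, lift a (st (cosetHom F u)) + k u • f)) '' corners st with hτ
  set c : AddCon (Fact S) := addConGen fun x y => (x, y) ∈ τ with hc
  have hle : c ≤ AddCon.ker (factHom S) := by
    refine AddCon.addConGen_le.2 ?_
    rintro x y ⟨u, hu, hxy⟩
    obtain ⟨rfl, rfl⟩ := Prod.mk.inj hxy
    change factHom S _ = factHom S _
    rw [hk u, map_add, map_nsmul, hfm]
  have key : ∀ z, ∃ j : ℕ, c (lift a z) (lift a (st (cosetHom F z)) + j • f) := by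
    intro z
    induction z using (wellFounded_weight hd.nonneg).induction with
    | _ z ih =>
    by_cases hzr : z ∈ Set.range st
    · rw [hd.mem_range_iff.1 hzr]
      exact ⟨0, by simpa using c.refl _⟩
    obtain ⟨u, hu, d, rfl⟩ := IsDegeneration.exists_corner_add hzr
    have h1 : c (lift a u) (lift a (st (cosetHom F u)) + k u • f) :=
      AddConGen.Rel.of _ _ ⟨u, hu, rfl⟩
    obtain ⟨j, hj⟩ := ih _ (hd.weight_rewrite_lt hu d)
    rw [hd.cosetHom_rewrite] at hj
    refine ⟨j + k u, ?_⟩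
    have h2 := c.add h1 (c.refl (lift a d))
    have h3 := c.add hj (c.refl (k u • f))
    rw [map_add (lift a)] at h3
    rw [map_add, add_nsmul, ← add_assoc]
    refine c.trans h2 ?_
    rw [add_right_comm]
    exact h3
  have hpres : IsPresentation S τ := by
    refine ⟨τ, le_antisymm hle fun x y hxy => ?_, ?_⟩
    · have hxy' : factHom S x = factHom S y := hxy
      have normal : ∀ y, ∃ q, ∃ j : ℕ, c y (lift a (st q) + j • f) := by
        intro y
        obtain ⟨z, j, rfl⟩ := h.exists_eq_lift_add hf y
        obtain ⟨i, hi⟩ := key z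
        refine ⟨cosetHom F z, i + j, ?_⟩
        rw [add_nsmul, ← add_assoc]
        exact c.add hi (c.refl _)
      obtain ⟨q, j, hq⟩ := normal x
      obtain ⟨q', j', hq'⟩ := normal y
      have e0 : factHom S (lift a (st q) + j • f) = factHom S (lift a (st q') + j' • f) :=
        (hle hq).symm.trans (hxy'.trans (hle hq'))
      rw [map_add, map_add, map_nsmul, map_nsmul, hfm] at e0
      -- The residue recovers `q`; cancelling the standard part then recovers `j`.
      have e1 := congrArg (residue H) e0
      rw [map_add, map_add, map_nsmul, map_nsmul, residue_modulus, nsmul_zero, nsmul_zero,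
        add_zero, add_zero, h.residue_factHom_lift, h.residue_factHom_lift, hd.cosetHom_st,
        hd.cosetHom_st] at e1
      subst e1
      have e2 := congrArg Subtype.val (add_left_cancel e0)
      have e3 : j * m = j' * m := by simpa using e2
      have e4 : j = j' := Nat.eq_of_mul_eq_mul_right (NeZero.pos m) e3
      subst e4
      exact c.trans hq (c.symm hq')
    · ext p
      simp [not_isNil_of_mem hm]
  exact (hσ.encard_le submonoid_wellFounded.1 submonoid_wellFounded.2 hpres).trans
    (Set.encard_image_le _ _)

theorem exists_eq_lift [NeZero m] (h : IsAperyProjection S F e a) {y : Fact S}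
    (hy : factHom S y ∈ apery S m) : ∃ z, y = lift a z := by
  induction y using Fact.induction with
  | h0 => exact ⟨0, by simp⟩
  | hadd y s ih =>
    rw [map_add, factHom_single, one_smul] at hy
    obtain ⟨z, rfl⟩ := ih (mem_apery_of_add_mem hy)
    obtain ⟨i, rfl⟩ := h.mem_range s fun hs => hy (factHom S (lift a z)) (by
      rw [AddSubmonoid.coe_add, hs])
    exact ⟨z + Finsupp.single i 1, by rw [map_add, lift_single]⟩

/-- Removing a shared atom from a minimal nil vector leaves an Apéry element, all of whose
factorizations lift from the nilsemigroup; unique factorization there leaves no second endpoint. -/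
theorem eq_of_fiberLink [NeZero m] (h : IsAperyProjection S F e a) (hm : m ∈ S)
    (hN : IsStaircase (KunzNil F)) {u : Fact (KunzNil F)} (hu : u ∈ minimalNil (KunzNil F))
    {y : Fact S} (hl : FiberLink (lift a u) y ∨ FiberLink y (lift a u)) : y = lift a u := by
  have hl' : FiberLink (lift a u) y := by
    rcases hl with hl | ⟨s, x', y', hxy, hx, hy⟩ | ⟨-, hn⟩
    · exact hl
    · exact Or.inl ⟨s, y', x', hxy.symm, hy, hx⟩
    · exact absurd hn (not_isNil_of_mem hm _)
  rcases hl' with ⟨s, x', y', hxy, hx, hy⟩ | ⟨-, hn⟩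
  · have hs : s ∈ (lift a u).support := by rw [hx]; simp
    obtain ⟨i, hi, rfl⟩ := Finset.mem_image.1 (Finsupp.mapDomain_support hs)
    have hx' : x' = lift a (u - Finsupp.single i 1) := by
      have e1 : lift a u = lift a (u - Finsupp.single i 1) + Finsupp.single (a i) 1 := by
        rw [← lift_single, ← map_add, ← exists_eq_add_single hi]
      rw [e1] at hx
      exact (add_right_cancel hx).symm
    have hn := hu.2 i hi
    have hA : factHom S y' ∈ apery S m := h.mem_apery (by
      rwa [← hxy, hx', h.apply_factHom_lift])
    obtain ⟨z, rfl⟩ := h.exists_eq_lift hA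
    have hz : u - Finsupp.single i 1 = z := hN.eq_of_factHom_eq (by
      rw [← h.apply_factHom_lift, ← h.apply_factHom_lift, ← hx', hxy]) hn
    rw [hx, hy, hx', hz]
  · exact absurd hn (not_isNil_of_mem hm _)

theorem encard_minimalNil_le [NeZero m] (h : IsAperyProjection S F e a)
    (hm : m ∈ Subtype.val '' atoms S) (hN : IsStaircase (KunzNil F))
    {σ : Set (Fact S × Fact S)} (hσ : IsPresentation S σ) :
    (minimalNil (KunzNil F)).encard ≤ σ.encard := by
  classical
  obtain ⟨⟨m', hmS⟩, hatom, rfl⟩ := hm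
  -- `χ` marks the lifts of minimal nil vectors and vanishes elsewhere. These lifts are isolated
  -- under `FiberLink`, so differences of `χ` along links are zero and only pairs of `σ` contribute.
  let χ : Fact S → (Fact (KunzNil F) →₀ ℚ) := fun y =>
    if hy : ∃ u ∈ minimalNil (KunzNil F), lift a u = y then Finsupp.single hy.choose 1 else 0
  have hχ : ∀ u ∈ minimalNil (KunzNil F), χ (lift a u) = Finsupp.single u 1 := by
    intro u hu
    have hy : ∃ v ∈ minimalNil (KunzNil F), lift a v = lift a u := ⟨u, hu, rfl⟩
    have : hy.choose = u := h.lift_injective hy.choose_spec.2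
    simp only [χ]
    rw [dif_pos hy, this]
  have hχ0 : ∀ y, (¬ ∃ u ∈ minimalNil (KunzNil F), lift a u = y) → χ y = 0 := fun y hy => by
    simp only [χ]
    rw [dif_neg hy]
  refine encard_le_of_linearIndepOn_of_subset_span
    (v := fun u : Fact (KunzNil F) => (Finsupp.single u 1 : Fact (KunzNil F) →₀ ℚ))
    (w := fun p : Fact S × Fact S => χ p.1 - χ p.2)
    ((Finsupp.linearIndependent_single_one ℚ _).linearIndepOn _) fun u hu => ?_
  have key : ∀ x y : Fact S, Linked σ x y →
      χ x - χ y ∈ Submodule.span ℚ ((fun p : Fact S × Fact S => χ p.1 - χ p.2) '' σ) := by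
    intro x y hxy
    induction hxy with
    | rel x y hxy =>
      rcases hxy with hxy | hxy
      · by_cases hx : ∃ u ∈ minimalNil (KunzNil F), lift a u = x
        · obtain ⟨u, hu, rfl⟩ := hx
          rw [h.eq_of_fiberLink hmS hN hu (Or.inl hxy), sub_self]
          exact zero_mem _
        by_cases hy : ∃ u ∈ minimalNil (KunzNil F), lift a u = y
        · obtain ⟨u, hu, rfl⟩ := hy
          rw [h.eq_of_fiberLink hmS hN hu (Or.inr hxy), sub_self]
          exact zero_mem _
        rw [hχ0 x hx, hχ0 y hy, sub_self]
        exact zero_mem _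
      · exact Submodule.subset_span ⟨_, hxy, rfl⟩
    | refl x => rw [sub_self]; exact zero_mem _
    | symm x y _ ih => rw [← neg_sub]; exact neg_mem ih
    | trans x y z _ _ ih1 ih2 => rw [← sub_add_sub_cancel]; exact add_mem ih1 ih2
  -- The value lies outside the Apéry set, so it has a second factorization using the atom `m'`.
  -- That one is no lift, because lifts avoid `m'`, so `χ` is zero there and the basis vector of `u`
  -- is in the span.
  have hnA : factHom S (lift a u) ∉ apery S m' := by
    intro hA
    have h1 := h.apply_factHom_lift u
    rw [h.of_mem _ hA] at h1
    exact KunzNil.not_isNil_of _ (h1 ▸ hu.1)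
  obtain ⟨k, hk⟩ := notMem_apery_iff.1 hnA
  obtain ⟨g, rfl⟩ := factHom_surjective_of_submonoid k
  set μ : atoms S := ⟨⟨m', hmS⟩, hatom⟩ with hμ
  have hval : factHom S (lift a u) = factHom S (g + Finsupp.single μ 1) := by
    rw [map_add, factHom_single, one_smul]
    exact Subtype.ext hk
  have h1 := key _ _ (hσ.linked hval)
  rw [hχ u hu, hχ0, sub_zero] at h1
  · exact h1
  · rintro ⟨v, -, hv⟩
    have h2 := DFunLike.congr_fun hv μ
    have h3 : lift a v μ = 0 := by
      refine Finsupp.mapDomain_of_notMem_range _ _ ?_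
      rintro ⟨i, hi⟩
      refine h.section_mem_apery i 0 ?_
      rw [hi]
      simp [hμ]
    rw [h3] at h2
    simp at h2

end IsAperyProjection

end NumericalSemigroup

end Kunz

namespace Kunz

variable {m : ℕ} {H : AddSubgroup (ZMod m)}

/-! ### Existence of a staircase coarsening by generic perturbation. -/

section StaircaseRefinement

/-- Encode vectors as integer polynomials and evaluate at a transcendental Liouville number. -/
theorem exists_injective_weight (ι : Type*) [Finite ι] :
    ∃ ε : (ι →₀ ℕ) →+ ℝ, Function.Injective ε ∧ ∀ i, 0 ≤ ε (Finsupp.single i 1) := by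
  classical
  obtain ⟨n, e⟩ := Finite.exists_equiv_fin ι
  obtain ⟨e⟩ := e
  -- Even exponents make the weights nonnegative as even powers, without knowing the sign of the
  -- number.
  let d : ι → ℕ := fun i => 2 * (e i : ℕ)
  have hd : Function.Injective d := fun i j hij => e.injective (Fin.ext (by
    simp only [d] at hij
    omega))
  let P : (ι →₀ ℕ) →+ Polynomial ℤ :=
    Finsupp.liftAddHom fun i => multiplesHom _ (Polynomial.X ^ d i : Polynomial ℤ)
  have hP : ∀ z i, (P z).coeff (d i) = (z i : ℤ) := by
    intro z i
    induction z using Finsupp.induction with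
    | zero => simp
    | single_add j k z _ _ ih =>
      rw [map_add, Polynomial.coeff_add, ih, Finsupp.add_apply]
      have : P (Finsupp.single j k) = k • (Polynomial.X ^ d j : Polynomial ℤ) := by simp [P]
      rw [this, Polynomial.coeff_smul, Polynomial.coeff_X_pow, Finsupp.single_apply]
      by_cases hij : j = i
      · simp [hij]
      · have : d i ≠ d j := fun h => hij (hd h).symm
        simp [hij, this]
  have hPinj : Function.Injective P := fun y z hyz => by
    ext i
    have := hP y i
    rw [hyz, hP] at this
    exact_mod_cast this.symm
  have ht := transcendental_iff_injective.1 (transcendental_liouvilleNumber (m := 2) le_rfl)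
  refine ⟨(Polynomial.aeval (liouvilleNumber (2 : ℕ)) :
    Polynomial ℤ →ₐ[ℤ] ℝ).toAddMonoidHom.comp P, ht.comp hPinj, fun i => ?_⟩
  change 0 ≤ Polynomial.aeval (liouvilleNumber (2 : ℕ)) (P (Finsupp.single i 1))
  simp only [P, Finsupp.liftAddHom_apply_single, multiplesHom_apply, one_smul, map_pow,
    Polynomial.aeval_X, d, pow_mul]
  positivity

variable {F : KunzFace m H}

theorem exists_factHom_eq_of [NeZero m] (F : KunzFace m H) (q : ZMod m ⧸ H) :
    ∃ z, factHom (KunzNil F) z = KunzNil.of q := by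
  obtain ⟨X, hX⟩ := exists_isInteriorPoint F
  have : IsTrans (ZMod m ⧸ H) fun p q => X p < X q := ⟨fun _ _ _ h h' => h.trans h'⟩
  have : Std.Irrefl (α := ZMod m ⧸ H) fun p q => X p < X q := ⟨fun _ => lt_irrefl _⟩
  have hwf := Finite.wellFounded_of_trans_of_irrefl fun p q : ZMod m ⧸ H => X p < X q
  induction q using hwf.induction with
  | _ q ih =>
  by_cases h0 : q = 0
  · exact ⟨0, by rw [map_zero, h0]; rfl⟩
  by_cases hq : (KunzNil.of q : KunzNil F) ∈ atoms (KunzNil F)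
  · exact ⟨Finsupp.single ⟨_, hq⟩ 1, by rw [factHom_single, one_smul]⟩
  have : ∃ b c : KunzNil F, b ≠ 0 ∧ c ≠ 0 ∧ KunzNil.of q = b + c := by
    by_contra hcon
    push Not at hcon
    refine hq ⟨fun h => h0 ?_, fun b c hb hc => hcon b c hb hc⟩
    rw [KunzNil.zero_def] at h
    simpa using h
  obtain ⟨b, c, hb, hc, hbc⟩ := this
  have hn := KunzNil.not_isNil_of (F := F) q
  rw [hbc] at hn
  rcases b with _ | b
  · exact absurd (KunzNil.isNil_iff.2 (KunzNil.nil_add _)) hn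
  rcases c with _ | c
  · exact absurd (KunzNil.isNil_iff.2 (KunzNil.add_nil _)) hn
  have ht := KunzNil.tight_of_not_isNil hn
  rw [KunzNil.of_add_of, if_pos ht, KunzNil.of.injEq] at hbc
  have hXq := (hX.tight_iff _ _).1 ht
  have hb' := hX.pos b fun h => hb (by rw [h]; rfl)
  have hc' := hX.pos c fun h => hc (by rw [h]; rfl)
  rw [← hbc] at hXq
  obtain ⟨y, hy⟩ := ih b (by linarith)
  obtain ⟨z, hz⟩ := ih c (by linarith)
  exact ⟨y + z, by rw [map_add, hy, hz, KunzNil.of_add_of, if_pos ht, hbc]⟩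

theorem KunzNil.eq_of_add {b c : KunzNil F} {q : ZMod m ⧸ H} (h : b + c = KunzNil.of q) :
    ∃ r s, b = KunzNil.of r ∧ c = KunzNil.of s ∧ F.Tight r s ∧ q = r + s := by
  have hn := KunzNil.not_isNil_of (F := F) q
  rw [← h] at hn
  rcases b with _ | b
  · exact absurd (KunzNil.isNil_iff.2 (KunzNil.nil_add _)) hn
  rcases c with _ | c
  · exact absurd (KunzNil.isNil_iff.2 (KunzNil.add_nil _)) hn
  have ht := KunzNil.tight_of_not_isNil hn
  rw [KunzNil.of_add_of, if_pos ht, KunzNil.of.injEq] at h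
  exact ⟨b, c, rfl, rfl, ht, h.symm⟩

theorem Fact.eq_zero_or_eq_add {N : Type*} [AddCommMonoid N] (z : Fact N) :
    z = 0 ∨ ∃ y i, z = y + Finsupp.single i 1 := by
  by_cases hz : z = 0
  · exact Or.inl hz
  · obtain ⟨i, hi⟩ := Finsupp.support_nonempty_iff.2 hz
    exact Or.inr ⟨_, i, exists_eq_add_single hi⟩

theorem factHom_eq_atom [NeZero m] {z : Fact (KunzNil F)} {i : atoms (KunzNil F)}
    (h : factHom _ z = i) : z = Finsupp.single i 1 := by
  obtain ⟨X, hX⟩ := exists_isInteriorPoint F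
  rcases Fact.eq_zero_or_eq_add z with rfl | ⟨y, j, rfl⟩
  · exact absurd (h.symm.trans (map_zero _)) i.2.1
  rw [map_add, factHom_single, one_smul] at h
  have hy : factHom _ y = 0 := by
    by_contra hy
    exact i.2.2 _ _ hy j.2.1 h.symm
  rw [hy, zero_add] at h
  rcases Fact.eq_zero_or_eq_add y with rfl | ⟨y, k, rfl⟩
  · rw [zero_add, Subtype.ext h]
  rw [map_add, factHom_single, one_smul] at hy
  obtain ⟨r, s, -, hs, ht, h0⟩ := KunzNil.eq_of_add hy
  have hXs := (hX.tight_iff _ _).1 ht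
  rw [← h0, hX.zero] at hXs
  have hs0 : s ≠ 0 := by
    rintro rfl
    exact k.2.1 hs
  linarith [hX.pos s hs0, hX.nonneg r]

/-- Perturb `X q` by `δ` times the least `ε`-weight of a factorization of `q` in `N`. The new tight
pairs are the old ones along which these least weights add, so in `N'` only the `ε`-least
factorizations survive. -/
theorem exists_staircase_refinement [NeZero m] (F : KunzFace m H) :
    ∃ F' : KunzFace m H, IsStaircase (KunzNil F') ∧ SameAtoms F F' ∧ Refines F F' := by
  obtain ⟨X, hX⟩ := exists_isInteriorPoint F
  obtain ⟨ε, hεinj, hε⟩ := exists_injective_weight (atoms (KunzNil F))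
  have hε0 := weight_nonneg hε
  choose st hst hmin using fun q : ZMod m ⧸ H => (wellFounded_weight hε).has_min
    {z | factHom (KunzNil F) z = KunzNil.of q} (exists_factHom_eq_of F q)
  have hst' : ∀ q, factHom _ (st q) = KunzNil.of q := hst
  have hle : ∀ z q, factHom _ z = KunzNil.of q → ε (st q) ≤ ε z :=
    fun z q hz => not_lt.1 (hmin q z hz)
  have hzero : ε (st 0) = 0 := by
    refine le_antisymm ?_ (hε0 _)
    simpa using hle 0 0 (by rw [map_zero]; rfl)
  have hsub : ∀ q r, F.Tight q r → ε (st (q + r)) ≤ ε (st q) + ε (st r) := fun q r ht => by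
    rw [← map_add]
    refine hle _ _ ?_
    rw [map_add, hst', hst', KunzNil.of_add_of, if_pos ht]
  obtain ⟨δ, hδ, hδ0⟩ : ∃ δ : ℝ, (∀ q r, ¬ F.Tight q r →
      X (q + r) + δ * ε (st (q + r)) < X q + X r + δ * (ε (st q) + ε (st r))) ∧ 0 < δ := by
    -- Finitely many inequalities, strict at `δ = 0`, persist for small positive `δ`.
    have h1 : ∀ᶠ δ : ℝ in nhdsWithin 0 (Set.Ioi 0), ∀ q r, ¬ F.Tight q r →
        X (q + r) + δ * ε (st (q + r)) < X q + X r + δ * (ε (st q) + ε (st r)) := by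
      simp only [Filter.eventually_all]
      intro q r ht
      refine Filter.Eventually.filter_mono nhdsWithin_le_nhds ?_
      refine ContinuousAt.eventually_lt (f := fun δ : ℝ => X (q + r) + δ * ε (st (q + r)))
        (g := fun δ : ℝ => X q + X r + δ * (ε (st q) + ε (st r))) (by fun_prop) (by fun_prop) ?_
      simp only [zero_mul, add_zero]
      exact lt_of_le_of_ne (hX.add_le q r) fun h => ht ((hX.tight_iff q r).2 h.symm)
    exact (h1.and self_mem_nhdsWithin).exists
  obtain ⟨F', hY⟩ := exists_kunzFace_of_subadditive (H := H)
    (Y := fun q => X q + δ * ε (st q)) (by rw [hX.zero, hzero, mul_zero, add_zero])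
    (fun q hq => add_pos_of_pos_of_nonneg (hX.pos q hq) (mul_nonneg hδ0.le (hε0 _)))
    (fun q r => by
      by_cases ht : F.Tight q r
      · have := mul_le_mul_of_nonneg_left (hsub q r ht) hδ0.le
        linarith [hX.add_le q r]
      · linarith [hδ q r ht])
  have htight : ∀ q r, F'.Tight q r ↔
      F.Tight q r ∧ ε (st (q + r)) = ε (st q) + ε (st r) := by
    intro q r
    rw [hY.tight_iff]
    constructor
    · intro h
      by_cases ht : F.Tight q r
      · have := (hX.tight_iff q r).1 ht
        refine ⟨ht, mul_left_cancel₀ hδ0.ne' ?_⟩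
        linarith
      · linarith [hδ q r ht]
    · rintro ⟨ht, h⟩
      rw [h, ← (hX.tight_iff q r).1 ht]
      ring
  have hatoms : SameAtoms F F' := by
    ext b
    constructor
    · rintro ⟨a, ha, rfl⟩
      have haq := KunzNil.of_coset_atom ⟨a, ha⟩
      change KunzNil.of a.coset = a at haq
      set q := a.coset
      rw [← haq] at ha ⊢
      have hq0 : q ≠ 0 := by
        rintro h
        exact ha.1 (by rw [h]; rfl)
      change KunzNil.of q ∈ _
      rcases Fact.eq_zero_or_eq_add (st q) with h | ⟨z, i, h⟩
      · have := hst' q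
        rw [h, map_zero, KunzNil.zero_def, KunzNil.of.injEq] at this
        exact absurd this.symm hq0
      have hz := hst' q
      rw [h, map_add, factHom_single, one_smul] at hz
      obtain ⟨r, s, hr, hs, ht, hq⟩ := KunzNil.eq_of_add hz
      -- Peeling an atom off an `ε`-least factorization splits it into factorizations of `r` and
      -- `s`, so least weights add here and the pair stays tight in `N'`.
      have ht' : F'.Tight r s := by
        refine (htight r s).2 ⟨ht, le_antisymm (hsub r s ht) ?_⟩
        rw [← hq, h, map_add]
        exact add_le_add (hle _ _ hr) (hle _ _ (by rw [factHom_single, one_smul, hs]))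
      by_cases hr0 : r = 0
      · rw [hq, hr0, zero_add, ← hs]
        exact i.2
      · refine absurd ?_ (ha.2 (.of r) (.of s) (fun h => hr0 ?_) fun h => i.2.1 ?_)
        · rw [KunzNil.of_add_of, if_pos ht', hq]
        · simpa [KunzNil.zero_def] using h
        · rw [hs, KunzNil.zero_def]
          simpa [KunzNil.zero_def] using h
    · intro hb
      have hbq := KunzNil.of_coset_atom ⟨b, hb⟩
      change KunzNil.of b.coset = b at hbq
      set q := b.coset
      rw [← hbq] at hb ⊢
      refine ⟨.of q, ⟨fun h => hb.1 ?_, fun c d hc hd hcd => ?_⟩, rfl⟩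
      · simpa [KunzNil.zero_def] using h
      · obtain ⟨r, s, rfl, rfl, ht, hq⟩ := KunzNil.eq_of_add hcd.symm
        refine hb.2 (.of r) (.of s) (fun h => hc ?_) (fun h => hd ?_) ?_
        · simpa [KunzNil.zero_def] using h
        · simpa [KunzNil.zero_def] using h
        · rw [KunzNil.of_add_of, if_pos ((htight r s).1 ht).1, hq]
  -- This gives refinement, and uniqueness too: every factorization in `N'` has the least `ε`-weight
  -- of its coset, and `ε` is injective.
  have key : ∀ z q, factHom (KunzNil F') z = KunzNil.of q →
      factHom (KunzNil F) (factEquiv hatoms z) = KunzNil.of q ∧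
        ε (factEquiv hatoms z) = ε (st q) := by
    intro z
    induction z using Fact.induction with
    | h0 =>
      intro q hq
      rw [map_zero, KunzNil.zero_def, KunzNil.of.injEq] at hq
      subst hq
      rw [map_zero, map_zero, map_zero, hzero]
      exact ⟨rfl, rfl⟩
    | hadd z i ih =>
      intro q hq
      rw [map_add, factHom_single, one_smul] at hq
      obtain ⟨r, s, hr, hs, ht, rfl⟩ := KunzNil.eq_of_add hq
      obtain ⟨h1, h2⟩ := ih r hr
      obtain ⟨ht1, ht2⟩ := (htight r s).1 ht
      have hgi : (atomsEquiv hatoms i : KunzNil F) = KunzNil.of s := by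
        rw [coe_atomsEquiv, hs]; rfl
      have hsts : st s = Finsupp.single (atomsEquiv hatoms i) 1 :=
        factHom_eq_atom ((hst' s).trans hgi.symm)
      rw [map_add, map_add, map_add, factEquiv_single, factHom_single, one_smul, h1, hgi,
        KunzNil.of_add_of, if_pos ht1, ht2, h2, ← hsts]
      exact ⟨rfl, rfl⟩
  refine ⟨F', ⟨inferInstance, KunzNil.isNilsemigroup F', KunzNil.isPartlyCancellative F',
    fun n hn => ?_⟩, hatoms, (refines_iff hatoms).2 fun q z hz => (key z q hz).1⟩
  obtain ⟨z, hz⟩ := exists_factHom_eq_of F' n.coset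
  rw [← KunzNil.of_coset hn]
  refine ⟨z, hz, fun y hy => (factEquiv hatoms).injective (hεinj ?_)⟩
  rw [(key y _ hy).2, (key z _ hz).2]

end StaircaseRefinement

end Kunz

theorem theoremt {m : ℕ} [NeZero m] {H : AddSubgroup (ZMod m)} (F : Kunz.KunzFace m H) :
    (∃ F' : Kunz.KunzFace m H,
      Kunz.IsStaircase (Kunz.KunzNil F') ∧ Kunz.SameAtoms F F' ∧ Kunz.Refines F F') ∧
    ∀ F' : Kunz.KunzFace m H,
      Kunz.IsStaircase (Kunz.KunzNil F') → Kunz.SameAtoms F F' → Kunz.Refines F F' →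
      (∀ ρ : Set (Kunz.Fact (Kunz.KunzNil F) × Kunz.Fact (Kunz.KunzNil F)),
        Kunz.IsMinimalPresentation (Kunz.KunzNil F) ρ →
        ρ.encard + (Kunz.outerBettiElements (Kunz.KunzNil F)).encard ≤
          (Kunz.outerBettiElements (Kunz.KunzNil F')).encard) ∧
      ∀ S S' : AddSubmonoid ℕ,
        Kunz.IsNumericalSemigroup S → Kunz.IsNumericalSemigroup S' →
        m ∈ S → m ∈ Subtype.val '' Kunz.atoms S' →
        Kunz.IsKunzNilsemigroupOf S F → Kunz.IsKunzNilsemigroupOf S' F' →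
        ∀ (σ : Set (Kunz.Fact S × Kunz.Fact S)) (σ' : Set (Kunz.Fact S' × Kunz.Fact S')),
          Kunz.IsMinimalPresentation S σ → Kunz.IsMinimalPresentation S' σ' →
          σ.encard ≤ σ'.encard := by
  refine ⟨Kunz.exists_staircase_refinement F, fun F' hs hat href => ?_⟩
  obtain ⟨w, st, hd, hcard⟩ := Kunz.exists_isDegeneration hs hat href
  refine ⟨fun ρ hρ => (hd.encard_add_encard_le hρ).trans (hcard.trans hs.encard_minimalNil_le),
    fun S S' _ _ hm hm' hS hS' σ σ' hσ hσ' => ?_⟩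
  obtain ⟨e, a, hea⟩ := hS.exists_projection hm
  have hmS' : m ∈ S' := by
    obtain ⟨s, -, rfl⟩ := hm'
    exact s.2
  obtain ⟨e', a', hea'⟩ := hS'.exists_projection hmS'
  exact (hea.encard_minimalPresentation_le hd hm hσ).trans
    (hcard.trans (hea'.encard_minimalNil_le hm' hs hσ'.prop))
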